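/- Let $\mathbb K$ be a field of characteristic zero, $\mathfrak g$ a finite-dimensional Lie algebra over $\mathbb K$, and $\mathfrak h\subset\mathfrak g$ a commutative ideal. **Notation.** For a finite-dimensional Lie algebra $L$ over a field $F$ of characteristic zero, $S(L)=F[L^*]$ carries the Lie–Poisson bracket, i.e. the skew-symmetric $F$-bilinear bracket that satisfies the Leibniz rule and extends the bracket of $L$; it extends to $\operatorname{Frac}S(L)=F(L^*)$. The index $\operatorname{ind}L$ is the corank of the form $(\xi,\eta)\mapsto\langle x,[\xi,\eta]\rangle$ for generic $x\in L^*$. A subalgebra $\mathcal A\subset S(L)$ is *commutative* if $\{\mathcal A,\mathcal A\}=0$, and a commutative subalgebra is *complete* if $\operatorname{trdeg}_F\mathcal A=\frac12(\dim L+\operatorname{ind}L)$. Put $\operatorname{Ann}(\mathfrak h)=\{f\in S(\mathfrak g)\mid\{f,\eta\}=0\ \ \forall\,\eta\in\mathfrak h\}$. Let $\mathbb K(\mathfrak h^*)=\operatorname{Frac}S(\mathfrak h)\subset\mathbb K(\mathfrak g^*)=\operatorname{Frac}S(\mathfrak g)$, and let $\pi:\mathfrak g^*\to\mathfrak h^*$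 be the projection. For $\lambda\in\mathfrak h^*$ let $\mathrm{St}(\lambda)=\{\xi\in\mathfrak g\mid\langle\lambda,[\xi,\eta]\rangle=0\ \ \forall\,\eta\in\mathfrak h\}$. The rational maps $\Psi:\mathfrak h^*\to\mathfrak g$ with $\Psi(\lambda)\in\mathrm{St}(\lambda)$ form a Lie algebra over $\mathbb K(\mathfrak h^*)$ with the pointwise bracket. Put $f_\Psi(x)=\langle x,\Psi(\pi(x))\rangle$ and let $L_{\mathfrak h}\subset\mathbb K(\mathfrak g^*)$ be the set of all these functions $f_\Psi$. With the Poisson bracket of $\mathbb K(\mathfrak g^*)$ it is a finite-dimensional Lie algebra over $\mathbb K(\mathfrak h^*)$. Let $\varepsilon:S(L_{\mathfrak h})\to\mathbb K(\mathfrak g^*)$ be the $\mathbb K(\mathfrak h^*)$-algebra homomorphism that is the inclusion on $L_{\mathfrak h}$, where $S(L_{\mathfrak h})$ is the symmetric algebra over $\mathbb K(\mathfrak h^*)$. The *polynomial part* of a $\mathbb K(\mathfrak h^*)$-subalgebra $\mathcal B\subset\mathbb K(\mathfrak g^*)$ is $\mathcal B_{\rm pol}=\mathcal B\cap S(\mathfrak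 g)$, and the *polynomialization* of a $\mathbb K(\mathfrak h^*)$-subalgebra $\mathcal A\subset S(L_{\mathfrak h})$ is $\mathcal A_{\rm pol}=\varepsilon(\mathcal A)\cap S(\mathfrak g)$. For $c\in\mathbb K(\mathfrak h^*)$ let $\theta_c$ be the algebra endomorphism of $S(L_{\mathfrak h})$ that multiplies the elements of $L_{\mathfrak h}$ by $c$. **Statement.** 1. If $S(L_{\mathfrak h})$ has a complete commutative subalgebra over $\mathbb K(\mathfrak h^*)$, then $S(\mathfrak g)$ has a complete commutative subalgebra over $\mathbb K$. (If the Mishchenko–Fomenko conjecture holds for $L_{\mathfrak h}$ over $\mathbb K(\mathfrak h^*)$, then it holds for $\mathfrak g$ over $\mathbb K$.) 2. If $\mathcal B\subset\varepsilon(S(L_{\mathfrak h}))$ is a $\mathbb K(\mathfrak h^*)$-subalgebra on which the Poisson bracket of $\mathbb K(\mathfrak g^*)$ vanishes, then $\mathcal B_{\rm pol}$ is a commutative subalgebra of $S(\mathfrak g)$ and is contained in $\operatorname{Ann}(\mathfrak h)$. 3. Let $\mathcal A\subset S(L_{\mathfrak h})$ be a complete commutative subalgebra over $\mathbb K(\mathfrak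 h^*)$. Then: - (a) $\mathcal A_{\rm pol}$ is commutative and is contained in $\operatorname{Ann}(\mathfrak h)$; - (b) if $\mathcal A$ is homogeneous (spanned by homogeneous elements), then $\mathcal A_{\rm pol}$ is a complete commutative subalgebra of $S(\mathfrak g)$ over $\mathbb K$; - (c) for all but finitely many $c\in\mathbb K(\mathfrak h^*)\setminus\{0\}$, the polynomialization $(\theta_c\mathcal A)_{\rm pol}$ is a complete commutative subalgebra of $S(\mathfrak g)$ over $\mathbb K$; - (d) if $\mathcal B\subset\varepsilon(S(L_{\mathfrak h}))$ is a commutative $\mathbb K(\mathfrak h^*)$-subalgebra (for example $\mathcal B=\varepsilon(\mathcal A)$) that has the largest transcendence degree over $\mathbb K(\mathfrak h^*)$ among all commutative $\mathbb K(\mathfrak h^*)$-subalgebras of $\varepsilon(S(L_{\mathfrak h}))$, then $\mathcal B_{\rm pol}$ is a complete commutative subalgebra of $S(\mathfrak g)$ over $\mathbb K$. -/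

import Mathlib

open scoped TensorProduct

noncomputable section

namespace LiePoisson

/-! ### Derivations of symmetric algebras and of their fraction fields -/

section Derivations

variable {R P Q : Type*} [CommRing R] [CommRing P] [CommRing Q] [Algebra R P] [Algebra R Q]
  [Algebra P Q] [IsScalarTower R P Q]

/-- An algebra homomorphism `f ↦ f + ε D f` into the dual numbers gives the derivation `D`. -/
def derivationOfDual (φ : P →ₐ[R] TrivSqZeroExt Q Q) (hφ : ∀ p, (φ p).fst = algebraMap P Q p) :
    Derivation R P Q where
  toFun p := (φ p).snd
  map_add' := by simp
  map_smul' := by simp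
  map_one_eq_zero' := by simp
  leibniz' a b := by
    simp [hφ, Algebra.smul_def, mul_comm]

/-- The homomorphism into the dual numbers with `x ↦ x + ε d x` on generators. -/
def dualLift {M : Type*} [AddCommGroup M] [Module R M] (j d : M →ₗ[R] Q) :
    SymmetricAlgebra R M →ₐ[R] TrivSqZeroExt Q Q :=
  SymmetricAlgebra.lift
    { toFun := fun x => TrivSqZeroExt.inl (j x) + TrivSqZeroExt.inr (d x)
      map_add' := by intro x y; ext <;> simp
      map_smul' := by intro c x; ext <;> simp }

theorem dualLift_fst {M : Type*} [AddCommGroup M] [Module R M] (j d : M →ₗ[R] Q)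
    (f : SymmetricAlgebra R M) : (dualLift j d f).fst = SymmetricAlgebra.lift j f := by
  have : (TrivSqZeroExt.fstHom R Q Q).comp (dualLift j d) = SymmetricAlgebra.lift j := by
    ext x; simp [dualLift]
  exact congrArg (fun F : SymmetricAlgebra R M →ₐ[R] Q => F f) this

end Derivations

section Field

variable (K g : Type*) [Field K] [LieRing g] [LieAlgebra K g]

/-- `RatFun K g` is the field `K(g*)` of rational functions on `g*`, that is `Frac S(g)`. -/
def RatFun : Type _ := FractionRing (SymmetricAlgebra K g)

instance instFieldRat : Field (RatFun K g) :=
  inferInstanceAs (Field (FractionRing (SymmetricAlgebra K g)))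

instance instAlgebraSymRat : Algebra (SymmetricAlgebra K g) (RatFun K g) :=
  inferInstanceAs (Algebra (SymmetricAlgebra K g) (FractionRing (SymmetricAlgebra K g)))

instance instAlgebraBaseRat : Algebra K (RatFun K g) :=
  inferInstanceAs (Algebra K (FractionRing (SymmetricAlgebra K g)))

instance instTowerSymRat : IsScalarTower K (SymmetricAlgebra K g) (RatFun K g) :=
  inferInstanceAs (IsScalarTower K (SymmetricAlgebra K g) (FractionRing (SymmetricAlgebra K g)))

instance instIsFractionRingRat : IsFractionRing (SymmetricAlgebra K g) (RatFun K g) :=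
  inferInstanceAs (IsFractionRing (SymmetricAlgebra K g) (FractionRing (SymmetricAlgebra K g)))

/-- The elements of `g` as linear functions on `g*`, inside `K(g*)`. -/
def linFun : g →ₗ[K] RatFun K g :=
  (IsScalarTower.toAlgHom K (SymmetricAlgebra K g) (RatFun K g)).toLinearMap ∘ₗ SymmetricAlgebra.ι K g

variable {K g}

/-- The derivation of `S(g)` with prescribed values on the generators `x ∈ g`. -/
def polyDer (d : g →ₗ[K] SymmetricAlgebra K g) :
    Derivation K (SymmetricAlgebra K g) (SymmetricAlgebra K g) :=
  derivationOfDual (dualLift (SymmetricAlgebra.ι K g) d)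
    (fun f => by rw [dualLift_fst, SymmetricAlgebra.lift_ι]; rfl)

@[simp] theorem polyDer_ι (d : g →ₗ[K] SymmetricAlgebra K g) (x : g) :
    polyDer d (SymmetricAlgebra.ι K g x) = d x := by
  change (dualLift (SymmetricAlgebra.ι K g) d (SymmetricAlgebra.ι K g x)).snd = d x
  simp [dualLift]

theorem lift_linFun (f : SymmetricAlgebra K g) :
    SymmetricAlgebra.lift (linFun K g) f = algebraMap _ (RatFun K g) f := by
  have : SymmetricAlgebra.lift (linFun K g) =
      IsScalarTower.toAlgHom K (SymmetricAlgebra K g) (RatFun K g) := by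
    ext x; simp [linFun]
  exact congrArg (fun F : SymmetricAlgebra K g →ₐ[K] RatFun K g => F f) this

theorem isUnit_dualLift (d : g →ₗ[K] RatFun K g) (y : nonZeroDivisors (SymmetricAlgebra K g)) :
    IsUnit (dualLift (linFun K g) d y) := by
  rw [TrivSqZeroExt.isUnit_iff_isUnit_fst, dualLift_fst, lift_linFun]
  exact IsLocalization.map_units _ y

/-- The derivation of `K(g*)` with prescribed values on the linear functions `x ∈ g`. -/
def ratDer (d : g →ₗ[K] RatFun K g) : Derivation K (RatFun K g) (RatFun K g) :=
  derivationOfDual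
    (IsLocalization.liftAlgHom (M := nonZeroDivisors (SymmetricAlgebra K g))
      (f := dualLift (linFun K g) d) (isUnit_dualLift d))
    (fun f => by
      have : ((TrivSqZeroExt.fstHom K (RatFun K g) (RatFun K g)).comp
          (IsLocalization.liftAlgHom (M := nonZeroDivisors (SymmetricAlgebra K g))
            (f := dualLift (linFun K g) d) (isUnit_dualLift d))) = AlgHom.id K (RatFun K g) := by
        apply IsLocalization.algHom_ext (nonZeroDivisors (SymmetricAlgebra K g))
        ext x
        have h := IsLocalization.lift_eq (S := RatFun K g) (isUnit_dualLift d)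
          (SymmetricAlgebra.ι K g x)
        have h2 := congrArg TrivSqZeroExt.fst h
        refine h2.trans ?_
        change (dualLift (linFun K g) d _).fst = _
        rw [dualLift_fst, lift_linFun]
        rfl
      exact congrArg (fun F : RatFun K g →ₐ[K] RatFun K g => F f) this)

@[simp] theorem ratDer_linFun (d : g →ₗ[K] RatFun K g) (x : g) : ratDer d (linFun K g x) = d x := by
  have h := IsLocalization.lift_eq (S := RatFun K g) (isUnit_dualLift d) (SymmetricAlgebra.ι K g x)
  refine (congrArg TrivSqZeroExt.snd h).trans ?_
  change (dualLift (linFun K g) d _).snd = _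
  simp [dualLift]

theorem polyDer_ext {Q : Type*} [AddCommGroup Q] [Module K Q] [Module (SymmetricAlgebra K g) Q]
    {D₁ D₂ : Derivation K (SymmetricAlgebra K g) Q}
    (h : ∀ x, D₁ (SymmetricAlgebra.ι K g x) = D₂ (SymmetricAlgebra.ι K g x)) : D₁ = D₂ := by
  ext f
  induction f using SymmetricAlgebra.induction with
  | algebraMap r => simp
  | ι x => exact h x
  | mul a b ha hb => simp [ha, hb]
  | add a b ha hb => simp [ha, hb]

theorem ratDer_ext {Q : Type*} [AddCommGroup Q] [Module K Q] [Module (RatFun K g) Q]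
    {D₁ D₂ : Derivation K (RatFun K g) Q}
    (h : ∀ x, D₁ (linFun K g x) = D₂ (linFun K g x)) : D₁ = D₂ := by
  have key : ∀ f : SymmetricAlgebra K g, D₁ (algebraMap _ _ f) = D₂ (algebraMap _ _ f) := by
    intro f
    induction f using SymmetricAlgebra.induction with
    | algebraMap r => simp [← IsScalarTower.algebraMap_apply]
    | ι x => exact h x
    | mul a b ha hb => simp [ha, hb]
    | add a b ha hb => simp [ha, hb]
  ext f
  obtain ⟨a, b, hb, rfl⟩ := IsFractionRing.div_surjective (A := SymmetricAlgebra K g) f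
  have hb' : (algebraMap _ (RatFun K g) b) ≠ 0 :=
    IsFractionRing.to_map_ne_zero_of_mem_nonZeroDivisors hb
  have e : algebraMap _ (RatFun K g) a = (algebraMap _ (RatFun K g) a / algebraMap _ (RatFun K g) b) *
      algebraMap _ (RatFun K g) b := by field_simp
  have h1 := key a
  rw [e, D₁.leibniz, D₂.leibniz, key b] at h1
  exact smul_right_injective Q hb' (add_left_cancel h1)

/-! ### The Lie-Poisson bracket -/

/-- The derivation `{x, ·}` of `S(g)` for `x ∈ g`, which extends `ad x`. -/
def adPoly (x : g) : Derivation K (SymmetricAlgebra K g) (SymmetricAlgebra K g) :=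
  polyDer (SymmetricAlgebra.ι K g ∘ₗ (LieAlgebra.ad K g x : g →ₗ[K] g))

/-- The derivation `{x, ·}` of `K(g*)` for `x ∈ g`. -/
def adRat (x : g) : Derivation K (RatFun K g) (RatFun K g) :=
  ratDer (linFun K g ∘ₗ (LieAlgebra.ad K g x : g →ₗ[K] g))

variable (K g) in
/-- `x ↦ {x, ·}` as a linear map. -/
def adPolyLin : g →ₗ[K] Derivation K (SymmetricAlgebra K g) (SymmetricAlgebra K g) where
  toFun := adPoly
  map_add' x y := polyDer_ext fun z => by simp [adPoly]
  map_smul' c x := polyDer_ext fun z => by simp [adPoly]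

variable (K g) in
/-- `x ↦ {x, ·}` as a linear map, on rational functions. -/
def adRatLin : g →ₗ[K] Derivation K (RatFun K g) (RatFun K g) where
  toFun := adRat
  map_add' x y := ratDer_ext fun z => by simp [adRat]
  map_smul' c x := ratDer_ext fun z => by simp [adRat]

/-- The Hamiltonian derivation `{f, ·}` of `S(g)`; its value at `y ∈ g` is `-{y, f}`. -/
def hamPoly (f : SymmetricAlgebra K g) :
    Derivation K (SymmetricAlgebra K g) (SymmetricAlgebra K g) :=
  polyDer
    { toFun := fun y => -adPolyLin K g y f
      map_add' := by intro x y; simp [add_comm]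
      map_smul' := by intro c x; simp }

/-- The Hamiltonian derivation `{f, ·}` of `K(g*)`. -/
def hamRat (f : RatFun K g) : Derivation K (RatFun K g) (RatFun K g) :=
  ratDer
    { toFun := fun y => -adRatLin K g y f
      map_add' := by intro x y; simp [add_comm]
      map_smul' := by intro c x; simp }

/-- The Lie-Poisson bracket on `S(g)`: the skew biderivation that extends the bracket of `g`. -/
def poisson (f₁ f₂ : SymmetricAlgebra K g) : SymmetricAlgebra K g := hamPoly f₁ f₂

/-- The Lie-Poisson bracket on `K(g*)`. -/
def ratPoisson (f₁ f₂ : RatFun K g) : RatFun K g := hamRat f₁ f₂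

theorem poisson_ι (x y : g) : poisson (SymmetricAlgebra.ι K g x) (SymmetricAlgebra.ι K g y) =
    SymmetricAlgebra.ι K g ⁅x, y⁆ := by
  simp [poisson, hamPoly, adPolyLin, adPoly, ← map_neg]

theorem ratPoisson_linFun (x y : g) : ratPoisson (linFun K g x) (linFun K g y) =
    linFun K g ⁅x, y⁆ := by
  simp [ratPoisson, hamRat, adRatLin, adRat, ← map_neg]

theorem hamPoly_add (a b : SymmetricAlgebra K g) : hamPoly (a + b) = hamPoly a + hamPoly b :=
  polyDer_ext fun z => by simp [hamPoly, add_comm]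

theorem hamPoly_mul (a b : SymmetricAlgebra K g) :
    hamPoly (a * b) = a • hamPoly b + b • hamPoly a :=
  polyDer_ext fun z => by simp [hamPoly, add_comm]

theorem hamRat_add (a b : RatFun K g) : hamRat (a + b) = hamRat a + hamRat b :=
  ratDer_ext fun z => by
    simp only [hamRat, ratDer_linFun, LinearMap.coe_mk, AddHom.coe_mk, map_add,
      Derivation.add_apply]
    exact neg_add _ _

theorem hamRat_mul (a b : RatFun K g) : hamRat (a * b) = a • hamRat b + b • hamRat a :=
  ratDer_ext fun z => by
    simp only [hamRat, ratDer_linFun, LinearMap.coe_mk, AddHom.coe_mk, Derivation.leibniz,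
      Derivation.add_apply, Derivation.smul_apply, smul_neg]
    exact neg_add _ _

theorem hamRat_smul (c : K) (a : RatFun K g) : hamRat (c • a) = c • hamRat a :=
  ratDer_ext fun z => by simp [hamRat]

/-- `f ↦ {f, h}` as a derivation. -/
def hamRatFlip (h : RatFun K g) : Derivation K (RatFun K g) (RatFun K g) where
  toFun f := ratPoisson f h
  map_add' := by simp [ratPoisson, hamRat_add]
  map_smul' := by simp [ratPoisson, hamRat_smul]
  map_one_eq_zero' := by
    have := hamRat_mul (1 : RatFun K g) 1
    have := congrArg (fun D => D h) this
    simpa [ratPoisson] using this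
  leibniz' := by simp [ratPoisson, hamRat_mul]

theorem ratPoisson_skew (f h : RatFun K g) : ratPoisson f h = -ratPoisson h f := by
  have step : ∀ x : g, ∀ f : RatFun K g, ratPoisson f (linFun K g x) = -ratPoisson (linFun K g x) f := by
    intro x
    have : hamRatFlip (linFun K g x) = -hamRat (linFun K g x) := ratDer_ext fun y => by
      change ratPoisson (linFun K g y) (linFun K g x) = -ratPoisson (linFun K g x) (linFun K g y)
      rw [ratPoisson_linFun, ratPoisson_linFun, ← map_neg, lie_skew]
    intro f
    exact congrArg (fun D => D f) this
  have : hamRat f = -hamRatFlip f := ratDer_ext fun x => step x f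
  exact congrArg (fun D => D h) this

theorem poisson_skew (f h : SymmetricAlgebra K g) : poisson f h = -poisson h f := by
  induction f using SymmetricAlgebra.induction generalizing h with
  | algebraMap r =>
    have : hamPoly (algebraMap K (SymmetricAlgebra K g) r) = 0 :=
      polyDer_ext fun z => by simp [hamPoly]
    simp [poisson, this]
  | ι x =>
    have key : ∀ h, poisson h (SymmetricAlgebra.ι K g x) =
        -poisson (SymmetricAlgebra.ι K g x) h := by
      intro h
      induction h using SymmetricAlgebra.induction with
      | algebraMap r =>
        have : hamPoly (algebraMap K (SymmetricAlgebra K g) r) = 0 :=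
          polyDer_ext fun z => by simp [hamPoly]
        simp [poisson, this]
      | ι y => rw [poisson_ι, poisson_ι, ← map_neg, lie_skew]
      | mul a b ha hb =>
        simp only [poisson, hamPoly_mul, Derivation.add_apply, Derivation.smul_apply,
          Derivation.leibniz] at ha hb ⊢
        rw [ha, hb]; simp; ring
      | add a b ha hb =>
        simp only [poisson, hamPoly_add, Derivation.add_apply, map_add] at ha hb ⊢
        rw [ha, hb]; ring
    rw [key, neg_neg]
  | mul a b ha hb =>
    have ha := ha h
    have hb := hb h
    simp only [poisson, hamPoly_mul, Derivation.add_apply, Derivation.smul_apply,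
      Derivation.leibniz] at ha hb ⊢
    rw [ha, hb]; simp; ring
  | add a b ha hb =>
    have ha := ha h
    have hb := hb h
    simp only [poisson, hamPoly_add, Derivation.add_apply, map_add] at ha hb ⊢
    rw [ha, hb]; ring

/-! ### Index and completeness -/

variable (K g) in
/-- The index of `g`: the corank of `Φ_x(ξ, η) = ⟨x, [ξ, η]⟩` for generic `x ∈ g*`, that is, the
least dimension of its kernel. -/
def index : ℕ :=
  ⨅ x : Module.Dual K g, Module.finrank K
    (LinearMap.ker ((LieAlgebra.ad K g : g →ₗ[K] Module.End K g).compr₂ x))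

/-- All Poisson brackets of elements of `A` vanish. -/
def IsCommutative (A : Subalgebra K (SymmetricAlgebra K g)) : Prop :=
  ∀ f₁ ∈ A, ∀ f₂ ∈ A, poisson f₁ f₂ = 0

/-- `A` is a complete commutative subalgebra of `S(g)`:
it is commutative and `trdeg A = (dim g + ind g) / 2`. -/
def IsCompleteCommutative (A : Subalgebra K (SymmetricAlgebra K g)) : Prop :=
  IsCommutative A ∧
    2 * Algebra.trdeg K A = ((Module.finrank K g + index K g : ℕ) : Cardinal)

variable (K g) in
/-- `S(g)` has a complete commutative subalgebra (the Mishchenko-Fomenko property of `g`). -/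
def HasCompleteCommutative : Prop :=
  ∃ A : Subalgebra K (SymmetricAlgebra K g), IsCompleteCommutative A

/-- The algebra endomorphism of `S(g)` that multiplies the elements of `g` by `c`. -/
def rescale (c : K) : SymmetricAlgebra K g →ₐ[K] SymmetricAlgebra K g :=
  SymmetricAlgebra.lift (c • SymmetricAlgebra.ι K g)

/-- `A` is homogeneous: spanned by its homogeneous elements. The elements of `S(g)` that are
homogeneous of degree `n` form the `n`-th power of the subspace `g`. -/
def IsHomogeneous (A : Subalgebra K (SymmetricAlgebra K g)) : Prop :=
  ∀ f ∈ A, f ∈ ⨆ n : ℕ, A.toSubmodule ⊓ (LinearMap.range (SymmetricAlgebra.ι K g)) ^ n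

/-- `Ann(h)`: the elements of `S(g)` that Poisson commute with `h`. -/
def ann (h : LieIdeal K g) : Subalgebra K (SymmetricAlgebra K g) where
  carrier := {f | ∀ η : h, poisson (SymmetricAlgebra.ι K g (η : g)) f = 0}
  mul_mem' ha hb η := by
    have h1 := ha η
    have h2 := hb η
    simp only [poisson] at h1 h2 ⊢
    simp [h1, h2]
  add_mem' ha hb η := by
    have h1 := ha η
    have h2 := hb η
    simp only [poisson] at h1 h2 ⊢
    simp [h1, h2]
  algebraMap_mem' r η := by simp [poisson]

end Field

/-! ### Rational sections of the stationary subalgebra bundle -/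

section Ideal

variable {K g : Type*} [Field K] [LieRing g] [LieAlgebra K g] (h : LieIdeal K g)

section Stationary

variable {h} {F : Type*} [Field F] [Algebra K F] (lam : h →ₗ[K] F)

/-- The `F`-linear map `Ψ ↦ ⟨lam, [Ψ, η]⟩` on `F ⊗ g`, for `η ∈ h` and an `F`-point `lam` of
`h*`. -/
def stPairing (η : h) : F ⊗[K] g →ₗ[F] F :=
  LinearMap.liftBaseChange (F)
    { toFun := fun ξ => lam ⁅ξ, η⁆
      map_add' := fun x y => by rw [add_lie, map_add]
      map_smul' := fun c x => by rw [smul_lie, map_smul, RingHom.id_apply] }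

@[simp] theorem stPairing_tmul (η : h) (a : F) (ξ : g) :
    stPairing lam η (a ⊗ₜ[K] ξ) = a * lam ⁅ξ, η⁆ := by
  rw [stPairing, LinearMap.liftBaseChange_tmul]; rfl

theorem stPairing_add (η₁ η₂ : h) (Ψ : F ⊗[K] g) :
    stPairing lam (η₁ + η₂) Ψ = stPairing lam η₁ Ψ + stPairing lam η₂ Ψ := by
  induction Ψ using TensorProduct.induction_on with
  | zero => simp only [map_zero, add_zero]
  | tmul a ξ => rw [stPairing_tmul, stPairing_tmul, stPairing_tmul, lie_add, map_add, mul_add]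
  | add x y hx hy => rw [map_add, map_add, map_add, hx, hy, add_add_add_comm]

theorem stPairing_smul (c : K) (η : h) (Ψ : F ⊗[K] g) :
    stPairing lam (c • η) Ψ = c • stPairing lam η Ψ := by
  induction Ψ using TensorProduct.induction_on with
  | zero => simp only [map_zero, smul_zero]
  | tmul a ξ => rw [stPairing_tmul, stPairing_tmul, lie_smul, map_smul, mul_smul_comm]
  | add x y hx hy => rw [map_add, map_add, hx, hy, smul_add]

/-- The `F`-linear map with `ξ ↦ ⟨lam, [Ψ, [ξ, η]]⟩` for `ξ ∈ g`. -/
def stPairing₂ (η : h) (Ψ : F ⊗[K] g) : F ⊗[K] g →ₗ[F] F :=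
  LinearMap.liftBaseChange (F)
    { toFun := fun ξ => stPairing lam ⁅ξ, η⁆ Ψ
      map_add' := fun x y => by rw [add_lie, stPairing_add]
      map_smul' := fun c x => by rw [smul_lie, stPairing_smul, RingHom.id_apply] }

theorem stPairing₂_tmul (η : h) (Ψ : F ⊗[K] g) (a : F) (ξ : g) :
    stPairing₂ lam η Ψ (a ⊗ₜ[K] ξ) = a * stPairing lam ⁅ξ, η⁆ Ψ := by
  rw [stPairing₂, LinearMap.liftBaseChange_tmul]; rfl

theorem stPairing₂_add (η : h) (Ψ₁ Ψ₂ Θ : F ⊗[K] g) :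
    stPairing₂ lam η (Ψ₁ + Ψ₂) Θ = stPairing₂ lam η Ψ₁ Θ + stPairing₂ lam η Ψ₂ Θ := by
  induction Θ using TensorProduct.induction_on with
  | zero => simp only [map_zero, add_zero]
  | tmul a ξ => rw [stPairing₂_tmul, stPairing₂_tmul, stPairing₂_tmul, map_add, mul_add]
  | add x y hx hy => rw [map_add, map_add, map_add, hx, hy, add_add_add_comm]

theorem stPairing₂_eq_zero {Ψ : F ⊗[K] g} (hΨ : ∀ η : h, stPairing lam η Ψ = 0) (η : h)
    (Θ : F ⊗[K] g) : stPairing₂ lam η Ψ Θ = 0 := by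
  induction Θ using TensorProduct.induction_on with
  | zero => rw [map_zero]
  | tmul a ξ => rw [stPairing₂_tmul, hΨ, mul_zero]
  | add x y hx hy => rw [map_add, hx, hy, add_zero]

theorem stPairing_lie (η : h) (Ψ₁ Ψ₂ : F ⊗[K] g) :
    stPairing lam η ⁅Ψ₁, Ψ₂⁆ = stPairing₂ lam η Ψ₁ Ψ₂ - stPairing₂ lam η Ψ₂ Ψ₁ := by
  induction Ψ₁ using TensorProduct.induction_on with
  | zero =>
    have e : ⁅(0 : F ⊗[K] g), Ψ₂⁆ = 0 := zero_lie (L := F ⊗[K] g) Ψ₂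
    rw [e, map_zero, map_zero, stPairing₂_eq_zero lam (fun _ => map_zero _), sub_zero]
  | add x y hx hy =>
    have e : ⁅x + y, Ψ₂⁆ = ⁅x, Ψ₂⁆ + ⁅y, Ψ₂⁆ := LieRing.add_lie x y Ψ₂
    rw [e, map_add, map_add, hx, hy, stPairing₂_add]; ring
  | tmul a ξ =>
    induction Ψ₂ using TensorProduct.induction_on with
    | zero =>
      have e : ⁅a ⊗ₜ[K] ξ, (0 : F ⊗[K] g)⁆ = 0 := lie_zero (L := F ⊗[K] g) _
      rw [e, map_zero, map_zero, stPairing₂_eq_zero lam (fun _ => map_zero _), sub_zero]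
    | add x y hx hy =>
      have e : ⁅a ⊗ₜ[K] ξ, x + y⁆ = ⁅a ⊗ₜ[K] ξ, x⁆ + ⁅a ⊗ₜ[K] ξ, y⁆ := LieRing.lie_add _ x y
      rw [e, map_add, map_add, hx, hy, stPairing₂_add]; ring
    | tmul b ζ =>
      rw [LieAlgebra.ExtendScalars.bracket_tmul, stPairing_tmul, stPairing₂_tmul, stPairing₂_tmul,
        stPairing_tmul, stPairing_tmul, lie_lie, map_sub]
      ring

/-- The stationary subalgebra `St(lam) ⊆ F ⊗ g` of an `F`-point `lam` of `h*` with respect to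
the action of `F ⊗ g` that is dual to the adjoint action on `h`: it consists of the `ξ` with
`⟨lam, [ξ, η]⟩ = 0` for all `η ∈ h`. -/
def stationary : LieSubalgebra (F) (F ⊗[K] g) where
  carrier := {Ψ | ∀ η : h, stPairing lam η Ψ = 0}
  add_mem' ha hb η := by rw [map_add, ha η, hb η, add_zero]
  zero_mem' η := by rw [map_zero]
  smul_mem' c Ψ hΨ η := by rw [map_smul, hΨ η, smul_zero]
  lie_mem' {Ψ₁ Ψ₂} h₁ h₂ η := by
    refine (stPairing_lie lam η Ψ₁ Ψ₂).trans ?_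
    rw [stPairing₂_eq_zero lam h₁, stPairing₂_eq_zero lam h₂, sub_zero]

end Stationary

/-- The inclusion `S(h) ⊆ S(g)` (pull-back of polynomials along the projection `g* → h*`). -/
def symIncl : SymmetricAlgebra K h →ₐ[K] SymmetricAlgebra K g :=
  SymmetricAlgebra.lift (SymmetricAlgebra.ι K g ∘ₗ (h : Submodule K g).subtype)

theorem symIncl_injective : Function.Injective (symIncl h) := by
  have ⟨p, hp⟩ : ∃ p : g →ₗ[K] h, ∀ x : h, p x = x := by
    obtain ⟨p, hp⟩ := (h : Submodule K g).subtype.exists_leftInverse_of_injective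
      (Submodule.ker_subtype _)
    exact ⟨p, fun x => LinearMap.congr_fun hp x⟩
  have : (SymmetricAlgebra.lift (SymmetricAlgebra.ι K h ∘ₗ p)).comp (symIncl h) =
      AlgHom.id K (SymmetricAlgebra K h) := by
    ext x
    change SymmetricAlgebra.lift (SymmetricAlgebra.ι K h ∘ₗ p)
      (symIncl h (SymmetricAlgebra.ι K h x)) = SymmetricAlgebra.ι K h x
    rw [symIncl, SymmetricAlgebra.lift_ι_apply]
    change SymmetricAlgebra.lift (SymmetricAlgebra.ι K h ∘ₗ p)
      (SymmetricAlgebra.ι K g (x : g)) = SymmetricAlgebra.ι K h x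
    rw [SymmetricAlgebra.lift_ι_apply, LinearMap.comp_apply, hp]
  exact Function.LeftInverse.injective (g := SymmetricAlgebra.lift (SymmetricAlgebra.ι K h ∘ₗ p))
    (fun x => congrArg (fun F : SymmetricAlgebra K h →ₐ[K] SymmetricAlgebra K h => F x) this)

theorem symIncl_rat_injective : Function.Injective
    ((IsScalarTower.toAlgHom K (SymmetricAlgebra K g) (RatFun K g)).comp (symIncl h)) :=
  (IsFractionRing.injective (SymmetricAlgebra K g) (RatFun K g)).comp (symIncl_injective h)

/-- The inclusion of fields `K(h*) ⊆ K(g*)` (pull-back along the projection `g* → h*`). -/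
def ratIncl : RatFun K h →ₐ[K] RatFun K g :=
  IsFractionRing.liftAlgHom (symIncl_rat_injective h)

instance instAlgebraRat : Algebra (RatFun K h) (RatFun K g) := (ratIncl h).toAlgebra

instance instTowerRat : IsScalarTower K (RatFun K h) (RatFun K g) :=
  IsScalarTower.of_algebraMap_eq fun r => ((ratIncl h).commutes r).symm

theorem ratIncl_linFun (η : h) :
    algebraMap (RatFun K h) (RatFun K g) (linFun K h η) = linFun K g (η : g) := by
  have := IsFractionRing.lift_algebraMap (K := RatFun K h) (symIncl_rat_injective h)
    (SymmetricAlgebra.ι K h η)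
  refine this.trans ?_
  change algebraMap _ _ (symIncl h (SymmetricAlgebra.ι K h η)) = _
  rw [symIncl, SymmetricAlgebra.lift_ι_apply]
  rfl

/-- The Lie algebra over `K(h*)` of rational sections of the stationary subalgebra bundle over
`h*`. A rational map `Ψ : h* → g` is an element of `K(h*) ⊗ g`, with the pointwise bracket; it is a
section if the rational function `λ ↦ ⟨λ, [Ψ(λ), η]⟩` is zero for all `η ∈ h`, that is, if `Ψ` lies
in the stationary subalgebra of the tautological (generic) point `η ↦ η` of `h*` over `K(h*)`. -/
def ratSections : LieSubalgebra (RatFun K h) (RatFun K h ⊗[K] g) := stationary (linFun K h)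

/-- `Ψ ↦ f_Ψ`, where `f_Ψ(x) = ⟨x, Ψ(π(x))⟩` and `π : g* → h*` is the projection. -/
def sectionFun : RatFun K h ⊗[K] g →ₗ[RatFun K h] RatFun K g :=
  (linFun K g).liftBaseChange (RatFun K h)

theorem sectionFun_tmul (a : RatFun K h) (ξ : g) :
    sectionFun h (a ⊗ₜ[K] ξ) = algebraMap (RatFun K h) (RatFun K g) a * linFun K g ξ := by
  rw [sectionFun, LinearMap.liftBaseChange_tmul, Algebra.smul_def]

/-! ### The Lie algebra `L_h` -/

theorem ratPoisson_mul_right (f a b : RatFun K g) :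
    ratPoisson f (a * b) = a * ratPoisson f b + b * ratPoisson f a := by
  simp [ratPoisson]

theorem ratPoisson_mul_left (f a b : RatFun K g) :
    ratPoisson (a * b) f = a * ratPoisson b f + b * ratPoisson a f := by
  simp [ratPoisson, hamRat_mul]

theorem ratPoisson_add_right (f a b : RatFun K g) :
    ratPoisson f (a + b) = ratPoisson f a + ratPoisson f b := by
  simp [ratPoisson]

theorem ratPoisson_add_left (f a b : RatFun K g) :
    ratPoisson (a + b) f = ratPoisson a f + ratPoisson b f := by
  simp [ratPoisson, hamRat_add]

theorem ratPoisson_zero_right (f : RatFun K g) : ratPoisson f 0 = 0 := by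
  simp [ratPoisson]

theorem ratPoisson_zero_left (f : RatFun K g) : ratPoisson 0 f = 0 := by
  rw [ratPoisson_skew, ratPoisson_zero_right, neg_zero]

theorem ratPoisson_base_eq_zero {f : RatFun K g}
    (hf : ∀ η : h, ratPoisson f (linFun K g (η : g)) = 0) (a : RatFun K h) :
    ratPoisson f (algebraMap (RatFun K h) (RatFun K g) a) = 0 := by
  have : (hamRat f).compAlgebraMap (RatFun K h) = 0 := ratDer_ext fun η => by
    have := hf η
    rw [← ratIncl_linFun] at this
    simpa [ratPoisson] using this
  exact congrArg (fun D => D a) this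

theorem ratPoisson_base_base [IsLieAbelian h] (a b : RatFun K h) :
    ratPoisson (algebraMap (RatFun K h) (RatFun K g) a) (algebraMap (RatFun K h) (RatFun K g) b) = 0 := by
  refine ratPoisson_base_eq_zero h (fun η => ?_) b
  rw [ratPoisson_skew, ratPoisson_base_eq_zero h (fun η' => ?_) a, neg_zero]
  have e : ⁅(η : g), (η' : g)⁆ = ((⁅η, η'⁆ : h) : g) := rfl
  rw [ratPoisson_linFun, e, trivial_lie_zero]
  exact map_zero _

theorem ratPoisson_sectionFun_linFun [IsLieAbelian h] (Ψ : RatFun K h ⊗[K] g) (η : h) :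
    ratPoisson (sectionFun h Ψ) (linFun K g (η : g)) =
      algebraMap (RatFun K h) (RatFun K g) (stPairing (linFun K h) η Ψ) := by
  induction Ψ using TensorProduct.induction_on with
  | zero => rw [map_zero, map_zero, map_zero, ratPoisson_zero_left]
  | add x y hx hy => rw [map_add, map_add, map_add, ratPoisson_add_left, hx, hy]
  | tmul a ξ =>
    have e : ⁅ξ, (η : g)⁆ = ((⁅ξ, η⁆ : h) : g) := rfl
    rw [sectionFun_tmul, ratPoisson_mul_left, ratPoisson_linFun, ← ratIncl_linFun,
      ratPoisson_base_base, mul_zero, add_zero, stPairing_tmul, map_mul, e, ratIncl_linFun]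

/-- Rational functions on `h*` Poisson commute with the functions `f_Ψ`. -/
theorem ratPoisson_sectionFun_base [IsLieAbelian h] {Ψ : RatFun K h ⊗[K] g}
    (hΨ : Ψ ∈ ratSections h) (a : RatFun K h) :
    ratPoisson (sectionFun h Ψ) (algebraMap (RatFun K h) (RatFun K g) a) = 0 :=
  ratPoisson_base_eq_zero h (fun η => by
    rw [ratPoisson_sectionFun_linFun, hΨ η, map_zero]) a

/-- The map `a ⊗ ξ ↦ ξ * {a, f}`. -/
def baseBracket (f : RatFun K g) : RatFun K h ⊗[K] g →ₗ[K] RatFun K g :=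
  TensorProduct.lift (LinearMap.mk₂ K
    (fun a ξ => linFun K g ξ * hamRatFlip f (algebraMap (RatFun K h) (RatFun K g) a))
    (fun a b ξ => by rw [map_add, map_add, mul_add])
    (fun c a ξ => by
      rw [Algebra.smul_def, map_mul, ← IsScalarTower.algebraMap_apply, ← Algebra.smul_def,
        Derivation.map_smul, mul_smul_comm])
    (fun a ξ ζ => by rw [map_add, add_mul])
    (fun c a ξ => by rw [map_smul, smul_mul_assoc]))

theorem baseBracket_tmul (f : RatFun K g) (a : RatFun K h) (ξ : g) :
    baseBracket h f (a ⊗ₜ[K] ξ) =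
      linFun K g ξ * ratPoisson (algebraMap (RatFun K h) (RatFun K g) a) f := rfl

theorem baseBracket_eq_zero {f : RatFun K g}
    (hf : ∀ a : RatFun K h, ratPoisson f (algebraMap (RatFun K h) (RatFun K g) a) = 0)
    (Θ : RatFun K h ⊗[K] g) : baseBracket h f Θ = 0 := by
  induction Θ using TensorProduct.induction_on with
  | zero => rw [map_zero]
  | tmul a ξ => rw [baseBracket_tmul, ratPoisson_skew, hf, neg_zero, mul_zero]
  | add x y hx hy => rw [map_add, hx, hy, add_zero]

theorem baseBracket_add (f₁ f₂ : RatFun K g) (Θ : RatFun K h ⊗[K] g) :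
    baseBracket h (f₁ + f₂) Θ = baseBracket h f₁ Θ + baseBracket h f₂ Θ := by
  induction Θ using TensorProduct.induction_on with
  | zero => simp only [map_zero, add_zero]
  | tmul a ξ => rw [baseBracket_tmul, baseBracket_tmul, baseBracket_tmul, ratPoisson_add_right,
      mul_add]
  | add x y hx hy => rw [map_add, map_add, map_add, hx, hy, add_add_add_comm]

theorem baseBracket_zero (Θ : RatFun K h ⊗[K] g) : baseBracket h 0 Θ = 0 :=
  baseBracket_eq_zero h (fun _ => ratPoisson_zero_left _) Θ

theorem ratPoisson_sectionFun_aux [IsLieAbelian h] (Ψ₁ Ψ₂ : RatFun K h ⊗[K] g) :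
    ratPoisson (sectionFun h Ψ₁) (sectionFun h Ψ₂) = sectionFun h ⁅Ψ₁, Ψ₂⁆ +
      baseBracket h (sectionFun h Ψ₂) Ψ₁ - baseBracket h (sectionFun h Ψ₁) Ψ₂ := by
  induction Ψ₁ using TensorProduct.induction_on with
  | zero =>
    have e : ⁅(0 : RatFun K h ⊗[K] g), Ψ₂⁆ = 0 := zero_lie (L := RatFun K h ⊗[K] g) Ψ₂
    rw [e, map_zero, map_zero, baseBracket_zero, ratPoisson_zero_left, add_zero, sub_zero]
  | add x y hx hy =>
    have e : ⁅x + y, Ψ₂⁆ = ⁅x, Ψ₂⁆ + ⁅y, Ψ₂⁆ := LieRing.add_lie x y Ψ₂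
    rw [e, map_add, map_add, map_add, ratPoisson_add_left, baseBracket_add, hx, hy]; ring
  | tmul a ξ =>
    induction Ψ₂ using TensorProduct.induction_on with
    | zero =>
      have e : ⁅a ⊗ₜ[K] ξ, (0 : RatFun K h ⊗[K] g)⁆ = 0 := lie_zero (L := RatFun K h ⊗[K] g) _
      rw [e, map_zero, map_zero, baseBracket_zero, ratPoisson_zero_right, add_zero, sub_zero]
    | add x y hx hy =>
      have e : ⁅a ⊗ₜ[K] ξ, x + y⁆ = ⁅a ⊗ₜ[K] ξ, x⁆ + ⁅a ⊗ₜ[K] ξ, y⁆ := LieRing.lie_add _ x y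
      rw [e, map_add, map_add, map_add, ratPoisson_add_right, baseBracket_add, hx, hy]; ring
    | tmul b ζ =>
      rw [LieAlgebra.ExtendScalars.bracket_tmul, sectionFun_tmul, sectionFun_tmul, sectionFun_tmul,
        baseBracket_tmul, baseBracket_tmul, ratPoisson_mul_left, ratPoisson_mul_right,
        ratPoisson_mul_right, ratPoisson_mul_right, ratPoisson_base_base,
        ratPoisson_base_base, ratPoisson_linFun, map_mul,
        ratPoisson_skew (algebraMap (RatFun K h) (RatFun K g) b)]
      ring

/-- On rational sections, `Ψ ↦ f_Ψ` turns the bracket of sections into the Poisson bracket. -/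
theorem ratPoisson_sectionFun [IsLieAbelian h] {Ψ₁ Ψ₂ : RatFun K h ⊗[K] g}
    (h₁ : Ψ₁ ∈ ratSections h) (h₂ : Ψ₂ ∈ ratSections h) :
    ratPoisson (sectionFun h Ψ₁) (sectionFun h Ψ₂) = sectionFun h ⁅Ψ₁, Ψ₂⁆ := by
  rw [ratPoisson_sectionFun_aux, baseBracket_eq_zero h (ratPoisson_sectionFun_base h h₁),
    baseBracket_eq_zero h (ratPoisson_sectionFun_base h h₂), add_zero, sub_zero]

/-- `L_h`: the image of the rational sections of the stationary subalgebra bundle under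
`Ψ ↦ f_Ψ`, a `K(h*)`-subspace of `K(g*)`. -/
def imageAlg : Submodule (RatFun K h) (RatFun K g) :=
  (ratSections h).toSubmodule.map (sectionFun h)

/-- The Lie algebra structure on `L_h` is the Poisson bracket of rational functions. -/
instance instLieRingImageAlg [IsLieAbelian h] : LieRing (imageAlg h) where
  bracket a b := ⟨ratPoisson (a : RatFun K g) (b : RatFun K g), by
    obtain ⟨_, Ψ₁, h₁, rfl⟩ := a
    obtain ⟨_, Ψ₂, h₂, rfl⟩ := b
    exact ⟨⁅Ψ₁, Ψ₂⁆, (ratSections h).lie_mem h₁ h₂, (ratPoisson_sectionFun h h₁ h₂).symm⟩⟩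
  add_lie a b c := Subtype.ext (ratPoisson_add_left (c : RatFun K g) a b)
  lie_add a b c := Subtype.ext (ratPoisson_add_right (a : RatFun K g) b c)
  lie_self a := by
    obtain ⟨_, Ψ, hΨ, rfl⟩ := a
    refine Subtype.ext ((ratPoisson_sectionFun h hΨ hΨ).trans ?_)
    have e : ⁅Ψ, Ψ⁆ = 0 := LieRing.lie_self Ψ
    rw [e]; exact map_zero _
  leibniz_lie a b c := by
    obtain ⟨_, Ψ₁, h₁, rfl⟩ := a
    obtain ⟨_, Ψ₂, h₂, rfl⟩ := b
    obtain ⟨_, Ψ₃, h₃, rfl⟩ := c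
    have h₁₂ := (ratSections h).lie_mem h₁ h₂
    have h₁₃ := (ratSections h).lie_mem h₁ h₃
    have h₂₃ := (ratSections h).lie_mem h₂ h₃
    refine Subtype.ext ?_
    change ratPoisson (sectionFun h Ψ₁) (ratPoisson (sectionFun h Ψ₂) (sectionFun h Ψ₃)) =
      ratPoisson (ratPoisson (sectionFun h Ψ₁) (sectionFun h Ψ₂)) (sectionFun h Ψ₃) +
      ratPoisson (sectionFun h Ψ₂) (ratPoisson (sectionFun h Ψ₁) (sectionFun h Ψ₃))
    rw [ratPoisson_sectionFun h h₂ h₃, ratPoisson_sectionFun h h₁ h₂,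
      ratPoisson_sectionFun h h₁ h₃]
    have e₁ := ratPoisson_sectionFun h h₁ h₂₃
    have e₂ := ratPoisson_sectionFun h h₁₂ h₃
    have e₃ := ratPoisson_sectionFun h h₂ h₁₃
    have e : ⁅Ψ₁, ⁅Ψ₂, Ψ₃⁆⁆ = ⁅⁅Ψ₁, Ψ₂⁆, Ψ₃⁆ + ⁅Ψ₂, ⁅Ψ₁, Ψ₃⁆⁆ := LieRing.leibniz_lie Ψ₁ Ψ₂ Ψ₃
    refine e₁.trans ?_
    rw [e, map_add]
    exact (congrArg₂ (· + ·) e₂ e₃).symm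

/-- `L_h` is a Lie algebra over `K(h*)`. -/
instance instLieAlgebraImageAlg [IsLieAbelian h] : LieAlgebra (RatFun K h) (imageAlg h) where
  lie_smul c a b := by
    obtain ⟨_, Ψ, hΨ, rfl⟩ := a
    refine Subtype.ext ?_
    change ratPoisson (sectionFun h Ψ) (c • (b : RatFun K g)) =
      c • ratPoisson (sectionFun h Ψ) (b : RatFun K g)
    rw [Algebra.smul_def, Algebra.smul_def, ratPoisson_mul_right,
      ratPoisson_sectionFun_base h hΨ, mul_zero, add_zero]

/-! ### Polynomialization -/

/-- `S(L_h) → K(g*)`: the polynomials over `K(h*)` in elements of `L_h`, read as rational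
functions on `g*`. -/
def evalRat [IsLieAbelian h] : SymmetricAlgebra (RatFun K h) (imageAlg h) →ₐ[RatFun K h] RatFun K g :=
  SymmetricAlgebra.lift (imageAlg h).subtype

/-- The Poisson brackets of elements of a subalgebra `B` of `K(g*)` vanish. -/
def IsRatCommutative (B : Subalgebra (RatFun K h) (RatFun K g)) : Prop :=
  ∀ f₁ ∈ B, ∀ f₂ ∈ B, ratPoisson f₁ f₂ = 0

/-- The polynomial part `B ∩ S(g)` of a `K(h*)`-subalgebra `B` of `K(g*)`. -/
def polyPart (B : Subalgebra (RatFun K h) (RatFun K g)) : Subalgebra K (SymmetricAlgebra K g) where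
  carrier := {f | algebraMap (SymmetricAlgebra K g) (RatFun K g) f ∈ B}
  mul_mem' ha hb := by
    change algebraMap _ _ _ ∈ B
    rw [map_mul]; exact B.mul_mem ha hb
  add_mem' ha hb := by
    change algebraMap _ _ _ ∈ B
    rw [map_add]; exact B.add_mem ha hb
  algebraMap_mem' r := by
    change algebraMap _ _ _ ∈ B
    rw [← IsScalarTower.algebraMap_apply, IsScalarTower.algebraMap_apply K (RatFun K h) (RatFun K g)]
    exact B.algebraMap_mem _

/-- The polynomialization of a `K(h*)`-subalgebra `A` of `S(L_h)`: the subalgebra of `S(g)` of all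
polynomials on `g*` that occur among the elements of `A`, read as rational functions on `g*`. -/
def polynomialization [IsLieAbelian h]
    (A : Subalgebra (RatFun K h) (SymmetricAlgebra (RatFun K h) (imageAlg h))) :
    Subalgebra K (SymmetricAlgebra K g) :=
  polyPart h (A.map (evalRat h))

end Ideal
end LiePoisson

end

/-! ### Minors and ranks of bilinear forms -/

section BilinearRank

open Module

variable {F M N : Type*} [Field F] [AddCommGroup M] [Module F M] [AddCommGroup N] [Module F N]

/-! The functions f_Ψ attached to sections of the stationary bundle Poisson commute with K(h*).
Since `h` is abelian, K(h*) also commutes with itself, so ε is a Poisson homomorphism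
(`ratPoisson_evalRat`) and carries commutative subalgebras to commutative ones. Every
K(h*)-subalgebra B of K(g*) contains S(h); if B is commutative, its polynomial part therefore lies
in Ann(h). If B lies in the image of ε, its elements have denominators in S(h), so B is algebraic
over its polynomial part, and the latter has transcendence degree dim h + trdeg B, the last degree
taken over K(h*) (`le_trdeg_polyPart`).

Only a lower bound on transcendence degrees is needed. The differentials of algebraically
independent commuting functions span an isotropic subspace for the Poisson form, whose corank over
K(g*) is ind g, and this gives the bound (dim g + ind g)/2 from above
(`two_mul_le_of_isCommutative`).

The obstacle is that ε is not injective when `h` ≠ 0: for η ≠ 0 in `h` the section η⁻¹ ⊗ η has f_Ψ =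
1, so L_h contains the constant 1 as an element of degree one, and ε identifies it with the unit of
S(L_h). Keeping track of the degree by a variable T repairs this: a ↦ aT embeds S(L_h) into K(g*)[T]
(`homogEval_injective`), and setting T = c gives ε ∘ θ_c (`eval_homogEval`). For almost all c,
specialization costs at most one in transcendence degree (`exists_finite_specialization`). If `h` =
0, then ε is injective and nothing is lost.

That this loss d ∈ {0, 1} is affordable is a dimension count (`dim_add_index_le`). Let W be the
orthogonal of the differentials of `h` under the Poisson form. It is coisotropic, its dimension is
at most that of the space of sections, and it contains the differentials of L_h, on which the form
has rank at least dim L_h - ind L_h. The radical of the form on W contains the orthogonal of W,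
which bounds that rank from above. Rank-nullity for Ψ ↦ f_Ψ turns this into dim g + ind g + 2d ≤ 2
dim h + dim L_h + ind L_h.

So the polynomialization of θ_c A is complete for almost all c. A homogeneous A equals θ_c A for c ≠
0, and a B of largest transcendence degree is at least as large as ε(θ_c A); both cases reduce to
one good c. -/

theorem exists_linearIndependent_comp_fin {V ι : Type*} [AddCommGroup V] [Module F V] [Finite ι]
    (x : ι → V) {r : ℕ} (hr : finrank F (Submodule.span F (Set.range x)) = r) :
    ∃ a : Fin r → ι, LinearIndependent F (x ∘ a) := by
  obtain ⟨κ, a, ha, hspan, hli⟩ := exists_linearIndependent' F x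
  have : Finite κ := Finite.of_injective a ha
  have := Fintype.ofFinite κ
  have hc : Fintype.card κ = r := by
    rw [← hr, ← hspan, finrank_span_eq_card hli]
  exact ⟨a ∘ (Fintype.equivFinOfCardEq hc).symm,
    hli.comp _ (Fintype.equivFinOfCardEq hc).symm.injective⟩

/-- Row rank picks the `v i`; the resulting matrix has independent rows, and since column rank
equals row rank, `r` independent columns can be chosen in it. -/
theorem exists_det_ne_zero_of_rank [FiniteDimensional F M] {ι κ : Type*} [Finite ι] [Fintype κ]
    (B : M →ₗ[F] N →ₗ[F] F) (b : Basis ι F M) (c : Basis κ F N) {r : ℕ}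
    (hr : finrank F (LinearMap.range B) = r) :
    ∃ (v : Fin r → ι) (w : Fin r → κ),
      (Matrix.of fun i j => B (b (v i)) (c (w j))).det ≠ 0 := by
  have hspan : LinearMap.range B = Submodule.span F (Set.range (B ∘ b)) := by
    rw [Set.range_comp, Submodule.span_image, b.span_eq, Submodule.map_top]
  rw [hspan] at hr
  obtain ⟨v, hv⟩ := exists_linearIndependent_comp_fin (B ∘ b) hr
  have hrow : LinearIndependent F (Matrix.of fun i j => B (b (v i)) (c j)).row := by
    rw [Fintype.linearIndependent_iff] at hv ⊢
    intro g hg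
    refine hv g (c.ext fun j => ?_)
    have := congrFun hg j
    simpa [Matrix.row] using this
  have hrk := hrow.rank_matrix
  rw [Matrix.rank_eq_finrank_span_cols, Fintype.card_fin] at hrk
  obtain ⟨w, hw⟩ := exists_linearIndependent_comp_fin _ hrk
  refine ⟨v, w, ?_⟩
  have : LinearIndependent F (Matrix.of fun i j => B (b (v i)) (c (w j))).col := hw
  rw [Matrix.linearIndependent_cols_iff_isUnit, Matrix.isUnit_iff_isUnit_det] at this
  exact this.ne_zero

theorem le_rank_of_det_ne_zero [FiniteDimensional F M] (B : M →ₗ[F] N →ₗ[F] F) {k : ℕ}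
    (v : Fin k → M) (w : Fin k → N) (h : (Matrix.of fun i j => B (v i) (w j)).det ≠ 0) :
    k ≤ finrank F (LinearMap.range B) := by
  have hli : LinearIndependent F (fun i => B (v i)) := by
    have hrow : LinearIndependent F (Matrix.of fun i j => B (v i) (w j)).row := by
      rw [Matrix.linearIndependent_rows_iff_isUnit, Matrix.isUnit_iff_isUnit_det]
      exact h.isUnit
    rw [Fintype.linearIndependent_iff] at hrow ⊢
    intro g hg
    refine hrow g (funext fun j => ?_)
    simpa [Matrix.row] using LinearMap.congr_fun hg (w j)
  have h1 := finrank_span_eq_card hli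
  rw [Fintype.card_fin] at h1
  rw [← h1]
  refine Submodule.finrank_mono (Submodule.span_le.mpr ?_)
  rintro _ ⟨i, rfl⟩
  exact LinearMap.mem_range_self B (v i)

theorem finrank_ker_add_le_of_det_ne_zero [FiniteDimensional F M] (B : M →ₗ[F] N →ₗ[F] F) {k : ℕ}
    (v : Fin k → M) (w : Fin k → N) (h : (Matrix.of fun i j => B (v i) (w j)).det ≠ 0) :
    finrank F (LinearMap.ker B) + k ≤ finrank F M := by
  have := le_rank_of_det_ne_zero B v w h
  have := LinearMap.finrank_range_add_finrank_ker B
  omega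

/-- The pairing `(v, w) ↦ ∑ v_i A_ij w_j`. -/
noncomputable def Matrix.pairing {ι κ : Type*} [Fintype ι] [Fintype κ] (A : Matrix ι κ F) :
    (ι → F) →ₗ[F] (κ → F) →ₗ[F] F :=
  (dotProductBilin F F).comp A.vecMulLinear

theorem Matrix.pairing_apply {ι κ : Type*} [Fintype ι] [Fintype κ] (A : Matrix ι κ F)
    (v : ι → F) (w : κ → F) : A.pairing v w = dotProduct (Matrix.vecMul v A) w := rfl

theorem Matrix.pairing_apply_single {ι κ : Type*} [Fintype ι] [Fintype κ] [DecidableEq κ]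
    (A : Matrix ι κ F) (v : ι → F) (j : κ) :
    A.pairing v (Pi.single j 1) = ∑ i, v i * A i j := by
  rw [pairing_apply, dotProduct_single_one]
  rfl

/-- A nonvanishing minor of maximal size stays nonzero after a field extension, so the rank cannot
drop. -/
theorem Matrix.finrank_ker_pairing_map_le {E ι κ : Type*} [Field E] [Algebra F E] [Fintype ι]
    [Fintype κ] (A : Matrix ι κ F) :
    finrank E (LinearMap.ker (A.map (algebraMap F E)).pairing) ≤
      finrank F (LinearMap.ker A.pairing) := by
  classical
  obtain ⟨v, w, hvw⟩ := exists_det_ne_zero_of_rank A.pairing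
    (Pi.basisFun F ι) (Pi.basisFun F κ) rfl
  have h3 := finrank_ker_add_le_of_det_ne_zero (A.map (algebraMap F E)).pairing
    (fun i => Pi.single (v i) 1) (fun i => Pi.single (w i) 1) (by
      have := (map_ne_zero_iff _ (algebraMap F E).injective).mpr hvw
      rw [RingHom.map_det] at this
      convert this using 2
      ext i j
      simp [pairing_apply_single, Pi.single_apply])
  have h4 := LinearMap.finrank_range_add_finrank_ker A.pairing
  rw [finrank_fintype_fun_eq_card] at h3 h4
  omega

/-- The rank of a reflexive form on a coisotropic subspace `W = H^⊥` drops by twice the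
codimension of `W`. -/
theorem minor_le_of_coisotropic [FiniteDimensional F M] {ω : LinearMap.BilinForm F M}
    (hω : ω.IsRefl) {H : Submodule F M} (hH : H ≤ ω.orthogonal H) {k : ℕ} (v w : Fin k → M)
    (hv : ∀ i, v i ∈ ω.orthogonal H) (hw : ∀ i, w i ∈ ω.orthogonal H)
    (h : (Matrix.of fun i j => ω (v i) (w j)).det ≠ 0) :
    k + finrank F M + finrank F (LinearMap.ker ω) ≤ 2 * finrank F (ω.orthogonal H) := by
  set W := ω.orthogonal H
  have h1 := finrank_ker_add_le_of_det_ne_zero (ω.restrict W)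
    (fun i => ⟨v i, hv i⟩) (fun i => ⟨w i, hw i⟩) h
  have h2 := LinearMap.BilinForm.finrank_add_finrank_orthogonal' (B := ω) W
  have h3 : ω.orthogonal W ≤ W := LinearMap.BilinForm.orthogonal_le hH
  have h4 : LinearMap.ker ω ≤ W := fun x hx y _ => hω x y (by
    rw [LinearMap.mem_ker.mp hx, LinearMap.zero_apply])
  -- As `W` contains the kernel of `ω`, the dimensions of `W` and its orthogonal add up to dim M +
  -- dim ker ω. That orthogonal lies in `W`, hence in the radical of the restricted form.
  rw [inf_eq_right.mpr h4] at h2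
  have h5 := Submodule.finrank_mono (LinearMap.BilinForm.inf_orthogonal_self_le_ker_restrict
    (W := W) hω)
  rw [inf_eq_right.mpr h3, Submodule.finrank_map_subtype_eq] at h5
  omega

/-- The span U of the vectors lies in its own orthogonal, and dim U + dim U^⊥ exceeds dim M only by
the dimension of U ∩ ker ω. -/
theorem two_mul_le_of_isotropic [FiniteDimensional F M] (ω : LinearMap.BilinForm F M)
    {k : ℕ} {v : Fin k → M} (hv : LinearIndependent F v) (h : ∀ i j, ω (v i) (v j) = 0) :
    2 * k ≤ finrank F M + finrank F (LinearMap.ker ω) := by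
  set U := Submodule.span F (Set.range v)
  have hU : finrank F U = k := by simpa using finrank_span_eq_card hv
  have hle : U ≤ ω.orthogonal U := by
    refine Submodule.span_le.mpr ?_
    rintro _ ⟨j, rfl⟩ y hy
    induction hy using Submodule.span_induction with
    | mem x hx => obtain ⟨i, rfl⟩ := hx; exact h i j
    | zero => simp
    | add x y _ _ hx hy =>
      change ω x (v j) = 0 at hx
      change ω y (v j) = 0 at hy
      change ω (x + y) (v j) = 0
      rw [map_add, LinearMap.add_apply, hx, hy, add_zero]
    | smul a x _ hx =>
      change ω x (v j) = 0 at hx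
      change ω (a • x) (v j) = 0
      rw [map_smul, LinearMap.smul_apply, hx, smul_zero]
  have h1 := Submodule.finrank_mono hle
  have h2 := LinearMap.BilinForm.finrank_add_finrank_orthogonal' (B := ω) U
  have h3 := Submodule.finrank_mono (inf_le_right : U ⊓ LinearMap.ker ω ≤ _)
  omega

end BilinearRank

/-! ### Algebraic independence -/

section AlgebraicIndependence

open Cardinal Polynomial

theorem natCast_le_trdeg_iff {R A : Type*} [Field R] [CommRing A]
    [IsDomain A] [Algebra R A] {k : ℕ} :
    (k : Cardinal) ≤ Algebra.trdeg R A ↔ ∃ f : Fin k → A, AlgebraicIndependent R f := by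
  constructor
  · intro h
    have := (faithfulSMul_iff_algebraMap_injective R A).mpr (algebraMap R A).injective
    obtain ⟨s, hs⟩ := exists_isTranscendenceBasis R A
    rw [← hs.cardinalMk_eq_trdeg] at h
    have : Cardinal.lift #(Fin k) ≤ Cardinal.lift #s := by simpa using h
    obtain ⟨e⟩ := Cardinal.lift_mk_le'.mp this
    exact ⟨_, hs.1.comp e e.injective⟩
  · rintro ⟨f, hf⟩
    simpa using hf.lift_cardinalMk_le_trdeg

theorem isAlgebraic_adjoin_trans {R A : Type*} [CommRing R] [CommRing A] [IsDomain A]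
    [Algebra R A] {s t : Set A} (ht : Algebra.IsAlgebraic (Algebra.adjoin R t) A)
    (h : ∀ x ∈ t, IsAlgebraic (Algebra.adjoin R s) x) :
    Algebra.IsAlgebraic (Algebra.adjoin R s) A :=
  ⟨fun a => (ht.1 a).adjoin_of_forall_isAlgebraic fun x hx => h x hx.1⟩

theorem isAlgebraic_of_mul_eq {R A : Type*} [CommRing R] [CommRing A] [Algebra R A]
    {r s : R} (hr : r ≠ 0) {a : A} (h : algebraMap R A r * a = algebraMap R A s) :
    IsAlgebraic R a := by
  refine ⟨C r * X - C s, fun h0 => hr ?_, by simp [h]⟩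
  simpa using congrArg (fun p => coeff p 1) h0

variable {F E : Type*} [Field F] [Field E] [Algebra F E]

theorem isTranscendenceBasis_X_sum {κ : Type*} {x : κ → E} (hx : IsTranscendenceBasis F x) :
    IsTranscendenceBasis F (Sum.elim (fun _ : Unit => (X : E[X])) (algebraMap E E[X] ∘ x)) :=
  hx.sumElim_comp (IsTranscendenceBasis.polynomial (ι := Unit) (R := E))

theorem isAlgebraic_of_subring_le {E : Type*} [CommRing E] {S T : Subring E} (hle : S ≤ T)
    (hS : Algebra.IsAlgebraic S E) : Algebra.IsAlgebraic T E := by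
  refine ⟨fun e => ?_⟩
  obtain ⟨p, hp0, hp⟩ := hS.1 e
  refine ⟨p.map (Subring.inclusion hle),
    (Polynomial.map_ne_zero_iff (Subring.inclusion_injective hle)).mpr hp0, ?_⟩
  rw [aeval_def] at hp ⊢
  rw [eval₂_map]
  exact hp

/-- Over `F` the `x i` become scalars, so `E` is algebraic over F[y]. Additivity of transcendence
degree in the tower shows that `y` has exactly the right number of elements. -/
theorem isTranscendenceBasis_of_tower {K : Type*} {F E : Type*} [Field K] [Field F] [Field E]
    [Algebra K F] [Algebra F E] [Algebra K E] [IsScalarTower K F E] {ι κ : Type*} [Finite ι]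
    [Finite κ] {x : ι → F} {y : κ → E} {z : ι ⊕ κ → E} (hx : IsTranscendenceBasis K x)
    (hz : IsTranscendenceBasis K z) (hzx : ∀ i, z (Sum.inl i) = algebraMap F E (x i))
    (hzy : ∀ j, z (Sum.inr j) = y j) : IsTranscendenceBasis F y := by
  have hle : Algebra.adjoin K (Set.range z) ≤
      (Algebra.adjoin F (Set.range y)).restrictScalars K := by
    have key : ∀ l, z l ∈ Algebra.adjoin F (Set.range y) := by
      rintro (i | j)
      · rw [hzx]
        exact Subalgebra.algebraMap_mem _ _
      · rw [hzy]
        exact Algebra.subset_adjoin ⟨j, rfl⟩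
    rw [Algebra.adjoin_le_iff]
    rintro _ ⟨l, rfl⟩
    exact key l
  have halg : Algebra.IsAlgebraic (Algebra.adjoin F (Set.range y)) E := by
    exact isAlgebraic_of_subring_le (S := (Algebra.adjoin K (Set.range z)).toSubring)
      (T := (Algebra.adjoin F (Set.range y)).toSubring) hle hz.isAlgebraic
  refine Algebra.IsAlgebraic.isTranscendenceBasis_of_lift_le_trdeg_of_finite _ y ?_
  have h1 := hx.lift_cardinalMk_eq_trdeg
  have h2 := hz.lift_cardinalMk_eq_trdeg
  have h3 := lift_trdeg_add_eq K F E
  have := Fintype.ofFinite ι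
  have := Fintype.ofFinite κ
  simp only [mk_fintype, Fintype.card_sum, lift_natCast] at h1 h2 ⊢
  have h4 := lift_eq_nat_iff.mp h1.symm
  have h5 := lift_eq_nat_iff.mp h2.symm
  rw [h4, h5, lift_natCast, lift_natCast] at h3
  have h6 := Cardinal.eq_of_add_eq_add_left (h3.trans (Nat.cast_add _ _)) natCast_lt_aleph0
  rw [lift_eq_nat_iff.mp h6, lift_natCast]

/-- Homogenizing a transcendence basis: `T` and the `x_j T` are algebraically independent. -/
theorem algebraicIndependent_homogenized {κ : Type*} [Finite κ] {x : κ → E}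
    (hx : IsTranscendenceBasis F x) :
    AlgebraicIndependent F (fun o : Option κ => o.elim (X : E[X]) fun j => C (x j) * X) := by
  set y := fun o : Option κ => o.elim (X : E[X]) fun j => C (x j) * X
  have hb := isTranscendenceBasis_X_sum hx
  have hX : (X : E[X]) ∈ Algebra.adjoin F (Set.range y) := Algebra.subset_adjoin ⟨none, rfl⟩
  have : Algebra.IsAlgebraic (Algebra.adjoin F (Set.range y)) E[X] := by
    refine isAlgebraic_adjoin_trans hb.isAlgebraic ?_
    rintro _ ⟨_ | j, rfl⟩
    · exact isAlgebraic_algebraMap (⟨X, hX⟩ : Algebra.adjoin F (Set.range y))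
    -- `x j` is recovered as the quotient of `x j * T` by `T`; counting elements then yields
    -- independence.
    · refine isAlgebraic_of_mul_eq (r := ⟨X, hX⟩)
        (s := ⟨C (x j) * X, Algebra.subset_adjoin ⟨some j, rfl⟩⟩)
        (fun h => X_ne_zero (congrArg Subtype.val h)) ?_
      exact mul_comm _ _
  refine (Algebra.IsAlgebraic.isTranscendenceBasis_of_lift_le_trdeg_of_finite F y ?_).1
  rw [mk_congr ((Equiv.optionEquivSumPUnit κ).trans (Equiv.sumComm κ Unit)),
    hb.lift_cardinalMk_eq_trdeg]

/-- If `p₁, …, p_k` are algebraically independent polynomials in one variable, then for almost all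
values of the variable, at least `k - 1` of their values are algebraically independent. -/
theorem exists_finite_specialization (hE : Algebra.trdeg F E < ℵ₀) {k : ℕ} {p : Fin k → E[X]}
    (hp : AlgebraicIndependent F p) :
    ∃ Z : Set F, Z.Finite ∧ ∀ c ∉ Z, ∃ e : Fin (k - 1) → Fin k,
      AlgebraicIndependent F fun i => (p (e i)).eval (algebraMap F E c) := by
  classical
  obtain ⟨s, hs⟩ := exists_isTranscendenceBasis F E
  have hsfin : Finite s := by
    rw [← hs.cardinalMk_eq_trdeg] at hE
    exact mk_lt_aleph0_iff.mp hE
  have hb := isTranscendenceBasis_X_sum hs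
  let M := AlgebraicIndependent.matroid F E[X]
  have hXind : M.Indep {(X : E[X])} := by
    rw [AlgebraicIndependent.matroid_indep_iff]
    have := (hb.1.comp (fun _ : Unit => Sum.inl ()) (fun _ _ _ => rfl)).to_subtype_range
    rwa [Set.range_comp, Set.range_unique, Set.image_singleton] at this
  -- In the algebraic matroid of `E[X]`, a basis of `X` together with the `p i` is chosen so as to
  -- contain `X`. It has at least `k` elements, and all but `X` are among the `p i`.
  obtain ⟨B, hB, hXB⟩ := hXind.subset_isBasis_of_subset
    (show {(X : E[X])} ⊆ insert X (Set.range p) by simp) (Set.subset_univ _)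
  have hBind : AlgebraicIndepOn F id B := hB.indep
  have hcardB : (k : ℕ∞) ≤ B.encard := by
    have hpi : M.Indep (Set.range p) := hp.to_subtype_range
    have h1 := hpi.encard_le_eRk_of_subset (Set.subset_insert X (Set.range p))
    rw [hB.eRk_eq_encard] at h1
    refine le_trans ?_ h1
    rw [← Set.image_univ, hp.injective.encard_image]
    simp
  obtain ⟨B', hBB', hB'⟩ : ∃ B', B ⊆ B' ∧ IsTranscendenceBasis F ((↑) : B' → E[X]) := by
    have := hb.isAlgebraic
    have h2 : Algebra.IsAlgebraic (Algebra.adjoin F (B ∪ Set.range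
        (Sum.elim (fun _ : Unit => (X : E[X])) (algebraMap E E[X] ∘ Subtype.val)))) E[X] :=
      isAlgebraic_adjoin_trans this fun x hx => isAlgebraic_algebraMap
        (⟨x, Algebra.subset_adjoin (Or.inr hx)⟩ : Algebra.adjoin F _)
    obtain ⟨u, h3, -, h4⟩ :=
      exists_isTranscendenceBasis_between (ht := h2) B _ Set.subset_union_left hBind
    exact ⟨u, h3, h4⟩
  have hXB' : (X : E[X]) ∈ B' := hBB' (hXB rfl)
  have hcard : Cardinal.lift #B' = Cardinal.lift #(Unit ⊕ s) :=
    hB'.lift_cardinalMk_eq hb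
  have hB'fin : Finite B' := by
    have : Cardinal.lift #B' < ℵ₀ := by
      rw [hcard, lift_lt_aleph0]; exact mk_lt_aleph0
    exact mk_lt_aleph0_iff.mp (by simpa using this)
  let D : Set E[X] := B' \ {X}
  have hDcard : Nat.card D = Nat.card s := by
    have h1 : Nat.card B' = Nat.card (Unit ⊕ s) := by
      have := congrArg Cardinal.toNat hcard
      simpa [Nat.card] using this
    rw [Nat.card_sum, Nat.card_unique (α := Unit)] at h1
    have h2 := Set.ncard_sdiff_singleton_add_one hXB' (Set.toFinite B')
    change D.ncard = _
    rw [← Nat.card_coe_set_eq] at h2 ⊢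
    change Nat.card D + 1 = Nat.card B' at h2
    omega
  -- Each member of a transcendence basis of `E` is algebraic over F[B']. Its equation survives `X =
  -- c` unless its leading coefficient vanishes at `c`; this excludes finitely many `c`.
  have hq : ∀ j : s, ∃ q : (Algebra.adjoin F B')[X], q ≠ 0 ∧ aeval (C (j : E)) q = 0 := fun j => by
    have := hB'.isAlgebraic
    rw [Subtype.range_coe] at this
    exact this.1 (C (j : E))
  choose q hq0 hq using hq
  refine ⟨⋃ j, {c | ((q j).leadingCoeff : E[X]).eval (algebraMap F E c) = 0},
    Set.finite_iUnion fun j => ?_, fun c hc => ?_⟩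
  · have hne : ((q j).leadingCoeff : E[X]) ≠ 0 := fun h =>
      hq0 j (leadingCoeff_eq_zero.mp (Subtype.ext h))
    refine ((((q j).leadingCoeff : E[X]).roots.toFinset.finite_toSet).preimage
      (algebraMap F E).injective.injOn).subset ?_
    intro c hc
    simpa [hne] using hc
  · simp only [Set.mem_iUnion, not_exists] at hc
    let ev : E[X] →ₐ[F] E := (aeval (algebraMap F E c)).restrictScalars F
    have hev : ∀ f, ev f = f.eval (algebraMap F E c) := fun f => by
      simp [ev, coe_aeval_eq_eval]
    let y : D → E := fun d => ev d
    have hmap : ∀ r : Algebra.adjoin F B', ev r ∈ Algebra.adjoin F (Set.range y) := by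
      have : (Algebra.adjoin F B').map ev ≤ Algebra.adjoin F (Set.range y) := by
        rw [AlgHom.map_adjoin, Algebra.adjoin_le_iff]
        rintro _ ⟨b, hb, rfl⟩
        by_cases hbX : b = X
        · rw [hbX, hev, eval_X]; exact Subalgebra.algebraMap_mem _ c
        · exact Algebra.subset_adjoin ⟨⟨b, hb, hbX⟩, rfl⟩
      exact fun r => this ⟨r, r.2, rfl⟩
    let φ : Algebra.adjoin F B' →ₐ[F] Algebra.adjoin F (Set.range y) :=
      (ev.comp (Algebra.adjoin F B').val).codRestrict _ hmap
    have halg : Algebra.IsAlgebraic (Algebra.adjoin F (Set.range y)) E := by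
      refine isAlgebraic_adjoin_trans hs.isAlgebraic ?_
      rintro _ ⟨j, rfl⟩
      refine ⟨(q j).map (φ : _ →+* _), fun h0 => hc j ?_, ?_⟩
      · have := congrArg (fun f => (f.coeff (q j).natDegree : E)) h0
        simp only [coeff_map, coeff_zero] at this
        exact (hev _).symm.trans this
      · have h1 := congrArg ev (hq j)
        rw [map_zero, aeval_def, ← AlgHom.coe_toRingHom, hom_eval₂] at h1
        rw [aeval_def, eval₂_map]
        refine Eq.trans ?_ h1
        simp only [AlgHom.coe_toRingHom, hev, eval_C]
        rfl
    have hDfin : Finite D := (Set.toFinite B').subset Set.sdiff_subset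
    -- The values at `c` of the elements of `B'` other than `X` generate a ring over which `E` is
    -- algebraic, and there are exactly trdeg E of them; so they are independent.
    have hy : IsTranscendenceBasis F y := by
      refine Algebra.IsAlgebraic.isTranscendenceBasis_of_lift_le_trdeg_of_finite F y ?_
      rw [← hs.cardinalMk_eq_trdeg]
      simp only [← Nat.cast_card, hDcard, lift_natCast, le_refl]
    have hPcard : k - 1 ≤ (B \ {X}).ncard := by
      have hBfin : B.Finite := (Set.toFinite B').subset hBB'
      rw [Set.ncard_sdiff_singleton_of_mem (hXB rfl)]
      rw [← hBfin.cast_ncard_eq] at hcardB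
      have : k ≤ B.ncard := by exact_mod_cast hcardB
      omega
    have : Finite (B \ {X} : Set E[X]) := ((Set.toFinite B').subset hBB').subset Set.sdiff_subset
    have := Fintype.ofFinite (B \ {X} : Set E[X])
    obtain ⟨u⟩ : Nonempty (Fin (k - 1) ↪ (B \ {X} : Set E[X])) := by
      refine Function.Embedding.nonempty_of_card_le ?_
      rwa [Fintype.card_fin, ← Nat.card_eq_fintype_card, Nat.card_coe_set_eq]
    have hu : ∀ i, ∃ l, p l = u i := fun i =>
      (hB.subset (u i).2.1).resolve_left (u i).2.2
    choose e he using hu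
    refine ⟨e, ?_⟩
    have := hy.1.comp (fun i => (⟨u i, hBB' (u i).2.1, (u i).2.2⟩ : D)) (fun i i' h =>
      u.injective (Subtype.ext (congrArg (fun d : D => (d : E[X])) h)))
    convert this using 1
    funext i
    simp only [he, Function.comp_apply, y, hev]

/-- Coordinates with respect to `y` identify `L` with a space of linear forms. A linear retraction
makes the map from its symmetric algebra to the polynomial ring split injective, and evaluation at
`y` is injective by independence. -/
theorem lift_injective_of_algebraicIndependent {L A ι : Type*} [AddCommGroup L] [Module F L]
    [CommRing A] [Algebra F A] {y : ι → A} (hy : AlgebraicIndependent F y) (φ : L →ₗ[F] A)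
    (hφ : Function.Injective φ) (hr : ∀ a, φ a ∈ Submodule.span F (Set.range y)) :
    Function.Injective (SymmetricAlgebra.lift φ) := by
  let j : L →ₗ[F] (ι →₀ F) := hy.linearIndependent.repr ∘ₗ φ.codRestrict _ hr
  have hj : ∀ a, Finsupp.linearCombination F y (j a) = φ a := fun a =>
    hy.linearIndependent.linearCombination_repr ⟨φ a, hr a⟩
  obtain ⟨r, hrj⟩ := j.exists_leftInverse_of_injective (LinearMap.ker_eq_bot.mpr fun a b h =>
    hφ (by rw [← hj, ← hj, h]))
  let τ : SymmetricAlgebra F L →ₐ[F] MvPolynomial ι F :=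
    SymmetricAlgebra.lift (Finsupp.linearCombination F MvPolynomial.X ∘ₗ j)
  let ψ : MvPolynomial ι F →ₐ[F] SymmetricAlgebra F L :=
    MvPolynomial.aeval fun i => SymmetricAlgebra.ι F L (r (Finsupp.single i 1))
  have h1 : (MvPolynomial.aeval y).comp τ = SymmetricAlgebra.lift φ := by
    refine SymmetricAlgebra.algHom_ext (LinearMap.ext fun a => ?_)
    change MvPolynomial.aeval y (τ (SymmetricAlgebra.ι F L a)) =
      SymmetricAlgebra.lift φ (SymmetricAlgebra.ι F L a)
    rw [SymmetricAlgebra.lift_ι_apply, SymmetricAlgebra.lift_ι_apply, ← hj a]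
    simp only [LinearMap.comp_apply, Finsupp.linearCombination_apply, map_finsuppSum,
      map_smul, MvPolynomial.aeval_X]
  have h2 : ψ.comp τ = AlgHom.id F _ := by
    refine SymmetricAlgebra.algHom_ext (LinearMap.ext fun a => ?_)
    change ψ (τ (SymmetricAlgebra.ι F L a)) = SymmetricAlgebra.ι F L a
    have h3 : r (j a) = a := LinearMap.congr_fun hrj a
    conv_rhs => rw [← h3, ← Finsupp.sum_single (j a), map_finsuppSum, map_finsuppSum]
    rw [SymmetricAlgebra.lift_ι_apply]
    simp only [LinearMap.comp_apply, Finsupp.linearCombination_apply, map_finsuppSum,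
      map_smul, ψ, MvPolynomial.aeval_X]
    refine Finsupp.sum_congr fun i _ => ?_
    rw [← map_smul, ← map_smul, Finsupp.smul_single, smul_eq_mul, mul_one]
  have h3 : Function.Injective τ := Function.LeftInverse.injective (g := ψ) fun f =>
    congrArg (fun G : SymmetricAlgebra F L →ₐ[F] SymmetricAlgebra F L => G f) h2
  rw [← h1, AlgHom.coe_comp]
  exact (algebraicIndependent_iff_injective_aeval.mp hy).comp h3

end AlgebraicIndependence

noncomputable section

namespace LiePoisson

/-! ### The Poisson tensor as a bilinear form over K(g*) -/

section PoissonForm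

open Module Polynomial

variable {K g : Type*} [Field K] [LieRing g] [LieAlgebra K g]

theorem adRatLin_algebraMap (x : g) (f : SymmetricAlgebra K g) :
    adRatLin K g x (algebraMap _ (RatFun K g) f) = algebraMap _ _ (adPolyLin K g x f) := by
  have : (adRatLin K g x).compAlgebraMap (SymmetricAlgebra K g) =
      (Algebra.linearMap (SymmetricAlgebra K g) (RatFun K g)).compDer (adPolyLin K g x) :=
    polyDer_ext fun y => by
      change ratDer _ (linFun K g y) = algebraMap _ _ (polyDer _ (SymmetricAlgebra.ι K g y))
      rw [ratDer_linFun, polyDer_ι]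
      rfl
  exact congrArg (fun D => D f) this

theorem algebraMap_poisson (f₁ f₂ : SymmetricAlgebra K g) :
    algebraMap _ (RatFun K g) (poisson f₁ f₂) =
      ratPoisson (algebraMap _ (RatFun K g) f₁) (algebraMap _ (RatFun K g) f₂) := by
  have : (hamRat (algebraMap _ (RatFun K g) f₁)).compAlgebraMap (SymmetricAlgebra K g) =
      (Algebra.linearMap (SymmetricAlgebra K g) (RatFun K g)).compDer (hamPoly f₁) :=
    polyDer_ext fun y => by
      change ratDer _ (linFun K g y) = algebraMap _ _ (polyDer _ (SymmetricAlgebra.ι K g y))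
      rw [ratDer_linFun, polyDer_ι]
      change -adRatLin K g y _ = algebraMap _ _ (-adPolyLin K g y f₁)
      rw [adRatLin_algebraMap, map_neg]
  exact (congrArg (fun D => D f₂) this).symm

theorem derivation_sum_apply {κ : Type*} (t : Finset κ)
    (D : κ → Derivation K (RatFun K g) (RatFun K g)) (f : RatFun K g) :
    (∑ i ∈ t, D i) f = ∑ i ∈ t, D i f := by
  classical
  induction t using Finset.induction_on with
  | empty => simp
  | insert i t hi ih => rw [Finset.sum_insert hi, Finset.sum_insert hi, Derivation.add_apply, ih]

variable {ι : Type*} (b : Basis ι K g)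

theorem isTranscendenceBasis_linFun : IsTranscendenceBasis K (linFun K g ∘ b) := by
  have h1 := (SymmetricAlgebra.equivMvPolynomial b).symm.isTranscendenceBasis
    (IsTranscendenceBasis.mvPolynomial ι K)
  have : Algebra.IsAlgebraic (SymmetricAlgebra K g) (RatFun K g) :=
    IsLocalization.isAlgebraic _ (nonZeroDivisors (SymmetricAlgebra K g))
  have h2 := h1.algebraMap_comp (A := RatFun K g)
  convert h2 using 1
  funext i
  simp [linFun]

/-- The partial derivatives of a rational function. -/
def grad (f : RatFun K g) : ι → RatFun K g := fun i =>
  ratDer (Algebra.linearMap K (RatFun K g) ∘ₗ b.coord i) f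

/-- A minor of the Poisson tensor in `S(g)`. -/
def bracketMinor {L : Type*} [LieRing L] [LieAlgebra K L] {k : ℕ} (v w : Fin k → L) :
    SymmetricAlgebra K L :=
  (Matrix.of fun i j => SymmetricAlgebra.ι K L ⁅v i, w j⁆).det

theorem lift_bracketMinor {A : Type*} [CommRing A] [Algebra K A] {k : ℕ} (v w : Fin k → g)
    (φ : g →ₗ[K] A) : SymmetricAlgebra.lift φ (bracketMinor v w) =
      (Matrix.of fun i j => φ ⁅v i, w j⁆).det := by
  rw [bracketMinor, AlgHom.map_det]
  congr 1
  ext i j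
  simp

/-- The infimum defining the index is attained at some `x`, and a maximal nonzero minor at `x` is
the value there of a polynomial minor. -/
theorem exists_minor_ne_zero [Fintype ι] [FiniteDimensional K g] :
    ∃ (k : ℕ) (v w : Fin k → ι), index K g + k = finrank K g ∧
    bracketMinor (K := K) (b ∘ v) (b ∘ w) ≠ 0 := by
  obtain ⟨x, hx⟩ : ∃ x : Dual K g, _ = index K g := ciInf_mem _
  obtain ⟨v, w, h⟩ := exists_det_ne_zero_of_rank
    ((LieAlgebra.ad K g : g →ₗ[K] Module.End K g).compr₂ x) b b rfl
  refine ⟨_, v, w, ?_, fun h0 => h ?_⟩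
  · rw [← hx, add_comm]
    exact LinearMap.finrank_range_add_finrank_ker _
  · have := lift_bracketMinor (b ∘ v) (b ∘ w) x
    rw [h0, map_zero] at this
    exact this.symm

/-- The chain rule: both sides are derivations, hence determined by their values on linear
functions. -/
theorem derivation_eq_sum [Fintype ι] (D : Derivation K (RatFun K g) (RatFun K g)) (f : RatFun K g) :
    D f = ∑ i, grad b f i * D (linFun K g (b i)) := by
  have : D = ∑ i, D (linFun K g (b i)) •
      ratDer (Algebra.linearMap K (RatFun K g) ∘ₗ b.coord i) := by
    refine ratDer_ext fun x => ?_
    conv_lhs => rw [← b.sum_repr x, map_sum, map_sum]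
    rw [derivation_sum_apply]
    refine Finset.sum_congr rfl fun i _ => ?_
    rw [map_smul, Derivation.map_smul, Derivation.smul_apply, ratDer_linFun]
    simp [Algebra.smul_def, mul_comm]
  conv_lhs => rw [this]
  simp [derivation_sum_apply, grad, mul_comm]

variable [DecidableEq ι]

theorem grad_linFun (i : ι) : grad b (linFun K g (b i)) = Pi.single i 1 := by
  funext j
  simp [grad, Finsupp.single_apply, Pi.single_apply, eq_comm]

variable [Fintype ι]

/-- The Poisson bivector as a bilinear form on differentials. -/
def poissonForm : LinearMap.BilinForm (RatFun K g) (ι → RatFun K g) :=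
  Matrix.toBilin' (Matrix.of fun i j => linFun K g ⁅b i, b j⁆)

theorem poissonForm_apply (v w : ι → RatFun K g) :
    poissonForm b v w = ∑ i, ∑ j, v i * linFun K g ⁅b i, b j⁆ * w j := by
  simp [poissonForm, Matrix.toBilin'_apply]

theorem poissonForm_single (i j : ι) :
    poissonForm b (Pi.single i 1) (Pi.single j 1) = linFun K g ⁅b i, b j⁆ := by
  simp [poissonForm, Matrix.toBilin'_single]

theorem poissonForm_skew (v w : ι → RatFun K g) : poissonForm b v w = -poissonForm b w v := by
  rw [poissonForm_apply, poissonForm_apply, Finset.sum_comm, ← Finset.sum_neg_distrib]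
  refine Finset.sum_congr rfl fun i _ => ?_
  rw [← Finset.sum_neg_distrib]
  refine Finset.sum_congr rfl fun j _ => ?_
  rw [← lie_skew, map_neg]
  ring

theorem poissonForm_isRefl : (poissonForm b).IsRefl := fun v w h => by
  rw [poissonForm_skew, h, neg_zero]

theorem ratPoisson_eq_poissonForm (f₁ f₂ : RatFun K g) :
    ratPoisson f₁ f₂ = poissonForm b (grad b f₁) (grad b f₂) := by
  rw [poissonForm_apply, Finset.sum_comm]
  refine (derivation_eq_sum b (hamRat f₁) f₂).trans (Finset.sum_congr rfl fun j _ => ?_)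
  have h1 : hamRat f₁ (linFun K g (b j)) = -hamRat (linFun K g (b j)) f₁ :=
    ratPoisson_skew f₁ (linFun K g (b j))
  rw [h1, derivation_eq_sum b (hamRat (linFun K g (b j))) f₁, ← Finset.sum_neg_distrib,
    Finset.mul_sum]
  refine Finset.sum_congr rfl fun i _ => ?_
  have h2 : hamRat (linFun K g (b j)) (linFun K g (b i)) = linFun K g ⁅b j, b i⁆ :=
    ratPoisson_linFun _ _
  rw [h2, ← lie_skew, map_neg]
  ring

/-! ### The Jacobian criterion -/

/-- `D` is linear over the algebra generated by `s`, so p(x) = 0 gives p'(x) D x = 0. If D x ≠ 0,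
derivatives of annihilating polynomials annihilate `x` too; in characteristic zero induction on the
degree leaves only p = 0. -/
theorem _root_.Derivation.eq_zero_of_isAlgebraic {K E : Type*} [Field K] [CharZero K] [Field E]
    [Algebra K E] (D : Derivation K E E) {s : Set E}
    (hs : Algebra.IsAlgebraic (Algebra.adjoin K s) E) (h : ∀ x ∈ s, D x = 0) : D = 0 := by
  have h0 : ∀ x ∈ Algebra.adjoin K s, D x = 0 := fun x hx =>
    Derivation.eqOn_adjoin (D1 := D) (D2 := 0) (fun x hx => h x hx) hx
  ext x
  rw [Derivation.zero_apply]
  let D' : Derivation (Algebra.adjoin K s) E E :=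
    Derivation.mk'
      { toFun := D
        map_add' := D.map_add
        map_smul' := fun c x => by
          rw [Algebra.smul_def, D.leibniz]
          have : D (algebraMap (Algebra.adjoin K s) E c) = 0 := h0 _ c.2
          rw [this, smul_zero, add_zero, RingHom.id_apply, smul_eq_mul, Algebra.smul_def] }
      D.leibniz
  by_contra hx
  obtain ⟨p, hp0, hp⟩ : ∃ p : (Algebra.adjoin K s)[X], p ≠ 0 ∧ aeval x p = 0 := hs.1 x
  have key : ∀ n, ∀ p : (Algebra.adjoin K s)[X], p.natDegree ≤ n → aeval x p = 0 → p = 0 := by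
    have : CharZero (Algebra.adjoin K s) :=
      charZero_of_injective_algebraMap (FaithfulSMul.algebraMap_injective K _)
    intro n
    induction n with
    | zero =>
      intro p hn hp
      rw [eq_C_of_natDegree_le_zero hn, aeval_C] at hp
      rw [eq_C_of_natDegree_le_zero hn, FaithfulSMul.algebraMap_injective _ E (hp.trans
        (map_zero _).symm), C_0]
    | succ n ih =>
      intro p hn hp
      have h1 := D'.map_aeval p x
      rw [hp, map_zero] at h1
      have h2 : aeval x (derivative p) = 0 := by
        have h3 : aeval x (derivative p) • D x = 0 := h1.symm
        exact (smul_eq_zero.mp h3).resolve_right hx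
      have h4 := ih (derivative p) ((natDegree_derivative_le p).trans (by omega)) h2
      have h5 := derivative_eq_zero.mp h4
      rw [eq_C_of_natDegree_eq_zero h5, aeval_C] at hp
      rw [eq_C_of_natDegree_eq_zero h5, FaithfulSMul.algebraMap_injective _ E (hp.trans
        (map_zero _).symm), C_0]
  exact hp0 (key _ p le_rfl hp)

/-- Differentials of algebraically independent functions are linearly independent. -/
theorem linearIndependent_grad [CharZero K] {κ : Type*} {f : κ → RatFun K g}
    (hf : AlgebraicIndependent K f) : LinearIndependent (RatFun K g) (grad b ∘ f) := by
  have hb := isTranscendenceBasis_linFun b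
  obtain ⟨s, hfs, hs⟩ := exists_isTranscendenceBasis_superset hf.to_subtype_range
  -- If the gradients of a transcendence basis did not span, a functional killing them would define
  -- a nonzero derivation vanishing on that basis. Spanning with the right cardinality then gives
  -- independence.
  have hspan : Submodule.span (RatFun K g) (Set.range (grad b ∘ ((↑) : s → RatFun K g))) = ⊤ := by
    by_contra hne
    obtain ⟨ψ, hψ, hle⟩ := Submodule.exists_le_ker_of_lt_top _ (lt_top_iff_ne_top.mpr hne)
    let D : Derivation K (RatFun K g) (RatFun K g) := ∑ i, ψ (Pi.single i 1) •
      ratDer (Algebra.linearMap K (RatFun K g) ∘ₗ b.coord i)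
    have hD : ∀ f, D f = ψ (grad b f) := fun f => by
      conv_rhs => rw [pi_eq_sum_univ' (grad b f), map_sum]
      simp only [D, derivation_sum_apply, Derivation.smul_apply, map_smul,
        smul_eq_mul]
      refine Finset.sum_congr rfl fun i _ => ?_
      rw [mul_comm]
      congr 2
    have hD0 : D = 0 := by
      refine D.eq_zero_of_isAlgebraic hs.isAlgebraic ?_
      rintro _ ⟨x, rfl⟩
      rw [hD]
      exact hle (Submodule.subset_span ⟨x, rfl⟩)
    refine hψ (LinearMap.pi_ext' fun i => LinearMap.ext_ring ?_)
    have := hD (linFun K g (b i))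
    rw [grad_linFun, hD0] at this
    exact this.symm
  have hcard := hs.lift_cardinalMk_eq hb
  have hfin : Finite s := by
    have : Cardinal.lift.{_, _} (Cardinal.mk s) < Cardinal.aleph0 := by
      rw [hcard]; simp
    exact Cardinal.mk_lt_aleph0_iff.mp (by simpa using this)
  have := Fintype.ofFinite s
  have hli : LinearIndependent (RatFun K g) (grad b ∘ ((↑) : s → RatFun K g)) := by
    refine linearIndependent_of_top_le_span_of_card_eq_finrank hspan.ge ?_
    rw [finrank_fintype_fun_eq_card]
    simpa using hcard
  exact hli.comp (fun i => ⟨f i, hfs ⟨i, rfl⟩⟩) fun i j h =>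
    hf.injective (congrArg Subtype.val h)

/-! ### Generic corank and the bound for commutative subalgebras -/

theorem exists_lift_ne_zero [Infinite K] {P : SymmetricAlgebra K g} (hP : P ≠ 0) :
    ∃ x : Dual K g, SymmetricAlgebra.lift x P ≠ 0 := by
  let c := Basis.ofVectorSpace K g
  by_contra! h
  refine hP ((SymmetricAlgebra.equivMvPolynomial c).injective ?_)
  rw [map_zero]
  refine MvPolynomial.funext fun a => ?_
  have : SymmetricAlgebra.lift (c.constr K a) = (MvPolynomial.aeval a).comp
      (SymmetricAlgebra.equivMvPolynomial c).toAlgHom := by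
    refine SymmetricAlgebra.algHom_ext (c.ext fun i => ?_)
    change SymmetricAlgebra.lift (c.constr K a) (SymmetricAlgebra.ι K g (c i)) =
      MvPolynomial.aeval a (SymmetricAlgebra.equivMvPolynomial c (SymmetricAlgebra.ι K g (c i)))
    simp
  have h2 := h (c.constr K a)
  rw [this] at h2
  simpa [MvPolynomial.aeval_eq_eval] using h2

variable [FiniteDimensional K g]

theorem index_le_of_minor_ne_zero [Infinite K] {k : ℕ} {v w : Fin k → g}
    (h : bracketMinor (K := K) v w ≠ 0) : index K g + k ≤ finrank K g := by
  obtain ⟨x, hx⟩ := exists_lift_ne_zero h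
  rw [lift_bracketMinor] at hx
  have h1 := finrank_ker_add_le_of_det_ne_zero
    ((LieAlgebra.ad K g : g →ₗ[K] Module.End K g).compr₂ x) v w hx
  have h2 : index K g ≤ _ := ciInf_le (OrderBot.bddBelow _) x
  omega

/-- Minors of the Poisson tensor are polynomials on g*. One that is nonzero at a point is nonzero
over K(g*), and conversely one that is nonzero over K(g*) is nonzero at some point because `K` is
infinite. -/
theorem finrank_ker_poissonForm [Infinite K] :
    finrank (RatFun K g) (LinearMap.ker (poissonForm b)) = index K g := by
  have hn : finrank (RatFun K g) (ι → RatFun K g) = finrank K g := by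
    rw [finrank_fintype_fun_eq_card, finrank_eq_card_basis b]
  have hminor : ∀ {k : ℕ} (v w : Fin k → ι),
      algebraMap _ (RatFun K g) (bracketMinor (K := K) (b ∘ v) (b ∘ w)) =
        (Matrix.of fun i j => poissonForm b (Pi.single (v i) 1) (Pi.single (w j) 1)).det := by
    intro k v w
    rw [← lift_linFun, lift_bracketMinor]
    simp only [poissonForm_single, Function.comp_apply]
  refine le_antisymm ?_ ?_
  · obtain ⟨k, v, w, hk, h⟩ := exists_minor_ne_zero b
    have h1 := finrank_ker_add_le_of_det_ne_zero (poissonForm b) _ _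
      (hminor v w ▸ (map_ne_zero_iff _ (IsFractionRing.injective _ (RatFun K g))).mpr h)
    omega
  · obtain ⟨v, w, h⟩ := exists_det_ne_zero_of_rank (poissonForm b)
      (Pi.basisFun (RatFun K g) ι) (Pi.basisFun (RatFun K g) ι) rfl
    simp only [Pi.basisFun_apply] at h
    rw [← hminor] at h
    have h1 := index_le_of_minor_ne_zero (ne_zero_of_map h)
    have h2 := LinearMap.finrank_range_add_finrank_ker (poissonForm b)
    omega

/-- The transcendence degree of a commutative subalgebra is at most `(dim g + ind g) / 2`. -/
theorem two_mul_le_of_isCommutative [CharZero K] {A : Subalgebra K (SymmetricAlgebra K g)}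
    (hA : IsCommutative A) {k : ℕ} (hk : (k : Cardinal) ≤ Algebra.trdeg K A) :
    2 * k ≤ finrank K g + index K g := by
  obtain ⟨f, hf⟩ := natCast_le_trdeg_iff.mp hk
  let b := finBasis K g
  let f' : Fin k → RatFun K g := fun i => algebraMap _ _ (f i : SymmetricAlgebra K g)
  have hf' : AlgebraicIndependent K f' :=
    hf.map' (f := (IsScalarTower.toAlgHom K (SymmetricAlgebra K g) (RatFun K g)).comp A.val)
      ((IsFractionRing.injective (SymmetricAlgebra K g) (RatFun K g)).comp
        (Subtype.val_injective (p := (· ∈ A))))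
  have h1 := two_mul_le_of_isotropic (poissonForm b) (linearIndependent_grad b hf')
    fun i j => by
      rw [Function.comp_apply, Function.comp_apply, ← ratPoisson_eq_poissonForm,
        ← algebraMap_poisson, hA _ (f i).2 _ (f j).2, map_zero]
  rwa [finrank_ker_poissonForm, finrank_fintype_fun_eq_card, Fintype.card_fin] at h1

theorem isCompleteCommutative_of_le [CharZero K] {A : Subalgebra K (SymmetricAlgebra K g)}
    (hA : IsCommutative A) {k : ℕ} (hk : (k : Cardinal) ≤ Algebra.trdeg K A)
    (h : finrank K g + index K g ≤ 2 * k) : IsCompleteCommutative A := by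
  refine ⟨hA, ?_⟩
  have hfin : Algebra.trdeg K A < Cardinal.aleph0 := by
    by_contra! hinf
    -- An infinite transcendence degree would exceed every natural number, in particular one that
    -- violates the upper bound.
    have := two_mul_le_of_isCommutative hA (k := finrank K g + index K g + 1)
      ((Cardinal.natCast_lt_aleph0).le.trans hinf)
    omega
  obtain ⟨t, ht⟩ := Cardinal.lt_aleph0.mp hfin
  have h1 := two_mul_le_of_isCommutative hA ht.ge
  rw [ht] at hk ⊢
  have h2 : k ≤ t := by exact_mod_cast hk
  have h3 : 2 * t = finrank K g + index K g := by omega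
  exact_mod_cast h3

end PoissonForm

/-! ### The embedding of S(L_h) into K(g*)[T] and the dimension count -/

section Reduction

open Module Polynomial

variable {K g : Type*} [Field K] [LieRing g] [LieAlgebra K g] (h : LieIdeal K g)

theorem linFun_ne_zero {x : g} (hx : x ≠ 0) : linFun K g x ≠ 0 := by
  intro h1
  obtain ⟨φ, hφ⟩ : ∃ φ : Dual K g, φ x ≠ 0 := by
    by_contra! hall
    exact hx ((forall_dual_apply_eq_zero_iff K x).mp hall)
  have h2 : SymmetricAlgebra.ι K g x = 0 :=
    IsFractionRing.injective (SymmetricAlgebra K g) (RatFun K g) (h1.trans (map_zero _).symm)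
  have h3 := congrArg (SymmetricAlgebra.lift φ) h2
  rw [SymmetricAlgebra.lift_ι_apply, map_zero] at h3
  exact hφ h3

theorem exists_adapted_basis [FiniteDimensional K g] :
    ∃ (m N : ℕ) (bh : Basis (Fin m) K h) (b : Basis (Fin m ⊕ Fin N) K g),
      ∀ i, b (Sum.inl i) = (bh i : g) := by
  have key : ∀ H : Submodule K g, ∃ (m N : ℕ) (bh : Basis (Fin m) K H)
      (b : Basis (Fin m ⊕ Fin N) K g), ∀ i, b (Sum.inl i) = (bh i : g) := fun H => by
    obtain ⟨q, hq⟩ := Submodule.exists_isCompl H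
    refine ⟨_, _, finBasis K H,
      ((finBasis K H).prod (finBasis K q)).map (Submodule.prodEquivOfIsCompl _ _ hq), fun i => ?_⟩
    simp
  exact key h

section Adapted

variable {h} {m N : ℕ} {bh : Basis (Fin m) K h} {b : Basis (Fin m ⊕ Fin N) K g}

theorem isTranscendenceBasis_complement (hb : ∀ i, b (Sum.inl i) = (bh i : g)) :
    IsTranscendenceBasis (RatFun K h) fun j : Fin N => linFun K g (b (Sum.inr j)) :=
  isTranscendenceBasis_of_tower (isTranscendenceBasis_linFun bh)
    (isTranscendenceBasis_linFun b)
    (fun i => by rw [Function.comp_apply, Function.comp_apply, ratIncl_linFun, hb]) fun _ => rfl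

theorem sectionFun_mem_of_basis {ι : Type*} (b : Basis ι K g)
    {U : Submodule (RatFun K h) (RatFun K g)} (hU : ∀ i, linFun K g (b i) ∈ U)
    (Ψ : RatFun K h ⊗[K] g) : sectionFun h Ψ ∈ U := by
  have key : ∀ ξ : g, linFun K g ξ ∈ U := fun ξ => by
    induction b.mem_span ξ using Submodule.span_induction with
    | mem x hx => obtain ⟨i, rfl⟩ := hx; exact hU i
    | zero => rw [map_zero]; exact U.zero_mem
    | add x y _ _ hx hy => rw [map_add]; exact U.add_mem hx hy
    | smul c x _ hx => rw [map_smul]; exact U.smul_of_tower_mem c hx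
  induction Ψ using TensorProduct.induction_on with
  | zero => rw [map_zero]; exact U.zero_mem
  | tmul a ξ => rw [sectionFun_tmul, ← Algebra.smul_def]; exact U.smul_mem _ (key ξ)
  | add x y hx hy => rw [map_add]; exact U.add_mem hx hy

/-- Linear functions coming from `h` are scalars in K(h*), so they only contribute multiples of 1.
-/
theorem sectionFun_mem_span (hb : ∀ i, b (Sum.inl i) = (bh i : g)) (Ψ : RatFun K h ⊗[K] g) :
    sectionFun h Ψ ∈ Submodule.span (RatFun K h)
      (Set.range fun o : Option (Fin N) => o.elim 1 fun j => linFun K g (b (Sum.inr j))) := by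
  refine sectionFun_mem_of_basis b (fun i => ?_) Ψ
  rcases i with i | j
  · rw [hb, ← ratIncl_linFun, Algebra.algebraMap_eq_smul_one]
    exact Submodule.smul_mem _ _ (Submodule.subset_span ⟨none, rfl⟩)
  · exact Submodule.subset_span ⟨some j, rfl⟩

end Adapted

/-- `a ↦ a T` for `a ∈ L_h`. -/
def homogLin : imageAlg h →ₗ[RatFun K h] (RatFun K g)[X] :=
  ((Polynomial.monomial 1).restrictScalars (RatFun K h)) ∘ₗ (imageAlg h).subtype

/-- The homomorphism `S(L_h) → K(g*)[T]` with `a ↦ a T` for `a ∈ L_h`. -/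
def homogEval : SymmetricAlgebra (RatFun K h) (imageAlg h) →ₐ[RatFun K h] (RatFun K g)[X] :=
  SymmetricAlgebra.lift (homogLin h)

theorem homogLin_apply (a : imageAlg h) : homogLin h a = C (a : RatFun K g) * X := by
  rw [C_mul_X_eq_monomial]
  rfl

theorem monomial_comp_elim {κ : Type*} (x : κ → RatFun K g) :
    ((Polynomial.monomial (R := RatFun K g) 1).restrictScalars (RatFun K h)) ∘
        (fun o : Option κ => o.elim 1 x) =
      fun o : Option κ => o.elim X fun j => C (x j) * X := by
  funext o
  rcases o with _ | j
  · exact monomial_one_one_eq_X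
  · exact C_mul_X_eq_monomial.symm

/-- After multiplication by T, L_h lies in the span of T and the `x_j T`, which are algebraically
independent; the constant 1 in L_h becomes T and is no longer confused with the unit. -/
theorem homogEval_injective [FiniteDimensional K g] : Function.Injective (homogEval h) := by
  obtain ⟨m, N, bh, b, hb⟩ := exists_adapted_basis h
  refine lift_injective_of_algebraicIndependent
    (algebraicIndependent_homogenized (isTranscendenceBasis_complement hb)) _
    (fun x y hxy => ?_) fun a => ?_
  · exact Subtype.ext (monomial_injective 1 hxy)
  · obtain ⟨_, Ψ, -, rfl⟩ := a
    have h1 := Submodule.mem_map_of_mem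
      (f := (Polynomial.monomial (R := RatFun K g) 1).restrictScalars (RatFun K h))
      (sectionFun_mem_span hb Ψ)
    rw [Submodule.map_span, ← Set.range_comp, monomial_comp_elim] at h1
    exact h1

instance [FiniteDimensional K g] : FiniteDimensional (RatFun K h) (imageAlg h) := by
  unfold imageAlg
  infer_instance

section Dimension

variable {h} {m N : ℕ} {bh : Basis (Fin m) K h} {b : Basis (Fin m ⊕ Fin N) K g}

variable (K g m N) in
/-- The span of the differentials of the linear functions from an ideal, in coordinates. -/
def idealSpan : Submodule (RatFun K g) (Fin m ⊕ Fin N → RatFun K g) :=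
  Submodule.span (RatFun K g) (Set.range fun i : Fin m => Pi.single (Sum.inl i) (1 : RatFun K g))

theorem mem_orthogonal_idealSpan {v : Fin m ⊕ Fin N → RatFun K g} :
    v ∈ (poissonForm b).orthogonal (idealSpan K g m N) ↔
      ∀ i, poissonForm b v (Pi.single (Sum.inl i) 1) = 0 := by
  constructor
  · intro hv i
    rw [poissonForm_skew, neg_eq_zero]
    exact hv _ (Submodule.subset_span ⟨i, rfl⟩)
  · intro hv y hy
    refine poissonForm_isRefl b v y ?_
    have : (idealSpan K g m N) ≤ LinearMap.ker (poissonForm b v) := by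
      refine Submodule.span_le.mpr ?_
      rintro _ ⟨i, rfl⟩
      exact hv i
    exact this hy

/-- Because `h` is an ideal, the equations that cut out this orthogonal have coefficients in K(h*).
Their solution space does not grow under extension to K(g*), and over K(h*) its elements are the
coordinates of rational sections. -/
theorem finrank_orthogonal_le (hb : ∀ i, b (Sum.inl i) = (bh i : g)) [FiniteDimensional K g] :
    finrank (RatFun K g) ((poissonForm b).orthogonal (idealSpan K g m N)) ≤
      finrank (RatFun K h) (ratSections h).toSubmodule := by
  let M : Matrix (Fin m ⊕ Fin N) (Fin m) (RatFun K h) :=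
    Matrix.of fun j i => linFun K h ⁅b j, bh i⁆
  let BF := Matrix.pairing M
  let BE := Matrix.pairing (M.map (algebraMap (RatFun K h) (RatFun K g)))
  have h1 : (poissonForm b).orthogonal (idealSpan K g m N) ≤ LinearMap.ker BE := by
    intro v hv
    rw [mem_orthogonal_idealSpan] at hv
    refine LinearMap.mem_ker.mpr ((Pi.basisFun (RatFun K g) (Fin m)).ext fun i => ?_)
    rw [Pi.basisFun_apply, LinearMap.zero_apply, ← hv i, poissonForm_apply,
      Matrix.pairing_apply_single]
    simp only [Matrix.map_apply, M, Matrix.of_apply]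
    refine Finset.sum_congr rfl fun j _ => ?_
    rw [Finset.sum_eq_single (Sum.inl i) (by intros; simp [*]) (by simp), hb]
    have e : ⁅b j, (bh i : g)⁆ = ((⁅b j, bh i⁆ : h) : g) := rfl
    rw [ratIncl_linFun, e]
    simp
  have h2 := Matrix.finrank_ker_pairing_map_le (A := M) (E := RatFun K g)
  refine (Submodule.finrank_mono h1).trans (h2.trans ?_)
  let T := (b.baseChange (RatFun K h)).equivFun.symm
  have hT : LinearMap.ker BF ≤ (ratSections h).toSubmodule.comap T.toLinearMap := by
    intro a ha η
    have hstep : ∀ i, stPairing (linFun K h) (bh i) (T a) = 0 := fun i => by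
      have h5 := LinearMap.congr_fun (LinearMap.mem_ker.mp ha) (Pi.single i 1)
      rw [Module.Basis.equivFun_symm_apply, map_sum]
      refine Eq.trans (Finset.sum_congr rfl fun j _ => ?_)
        ((Matrix.pairing_apply_single M a i).symm.trans h5)
      rw [map_smul, Basis.baseChange_apply, stPairing_tmul]
      simp [M]
    induction bh.mem_span η using Submodule.span_induction with
    | mem x hx => obtain ⟨i, rfl⟩ := hx; exact hstep i
    | zero => simpa using stPairing_smul (linFun K h) (0 : K) (0 : h) (T a)
    | add x y _ _ hx hy =>
      rw [stPairing_add]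
      exact (congrArg₂ _ hx hy).trans (add_zero _)
    | smul c x _ hx =>
      rw [stPairing_smul]
      exact (congrArg _ hx).trans (smul_zero _)
  calc finrank (RatFun K h) (LinearMap.ker BF)
      = finrank (RatFun K h) ((LinearMap.ker BF).map T.toLinearMap) :=
        (LinearEquiv.finrank_map_eq T _).symm
    _ ≤ _ := Submodule.finrank_mono (Submodule.map_le_iff_le_comap.mpr hT)

/-- Rank-nullity for Ψ ↦ f_Ψ, once on all of K(h*) ⊗ g and once on the sections: the kernel on the
sections is no larger than the whole kernel. -/
theorem finrank_sections_add_card_le [FiniteDimensional K g] {κ : Type*} [Fintype κ]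
    {y : κ → RatFun K g} (hy : LinearIndependent (RatFun K h) y)
    (hr : ∀ i, y i ∈ LinearMap.range (sectionFun h)) :
    finrank (RatFun K h) (ratSections h).toSubmodule + Fintype.card κ ≤
      finrank (RatFun K h) (imageAlg h) + finrank K g := by
  have h1 := LinearMap.finrank_range_add_finrank_ker (sectionFun h)
  have h2 := LinearMap.finrank_range_add_finrank_ker
    ((sectionFun h).domRestrict (ratSections h).toSubmodule)
  rw [LinearMap.range_domRestrict] at h2
  have h3 : Fintype.card κ ≤ finrank (RatFun K h) (LinearMap.range (sectionFun h)) := by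
    rw [← finrank_span_eq_card hy]
    refine Submodule.finrank_mono (Submodule.span_le.mpr ?_)
    rintro _ ⟨i, rfl⟩
    exact hr i
  have h4 : finrank (RatFun K h)
      (LinearMap.ker ((sectionFun h).domRestrict (ratSections h).toSubmodule)) ≤
      finrank (RatFun K h) (LinearMap.ker (sectionFun h)) := by
    rw [← Submodule.finrank_map_subtype_eq]
    refine Submodule.finrank_mono ?_
    rintro _ ⟨x, hx, rfl⟩
    exact hx
  rw [Module.finrank_baseChange] at h1
  change finrank (RatFun K h) (imageAlg h) + _ = _ at h2
  omega

variable [IsLieAbelian h]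

theorem idealSpan_isotropic (hb : ∀ i, b (Sum.inl i) = (bh i : g)) :
    (idealSpan K g m N) ≤ (poissonForm b).orthogonal (idealSpan K g m N) := by
  refine Submodule.span_le.mpr ?_
  rintro _ ⟨i, rfl⟩
  refine mem_orthogonal_idealSpan.mpr fun j => ?_
  have e : ⁅(bh i : g), (bh j : g)⁆ = ((⁅bh i, bh j⁆ : h) : g) := rfl
  rw [poissonForm_single, hb, hb, e, trivial_lie_zero]
  exact map_zero _

theorem grad_mem_orthogonal (hb : ∀ i, b (Sum.inl i) = (bh i : g)) (a : imageAlg h) :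
    grad b (a : RatFun K g) ∈ (poissonForm b).orthogonal (idealSpan K g m N) := by
  refine mem_orthogonal_idealSpan.mpr fun i => ?_
  rw [← grad_linFun, ← ratPoisson_eq_poissonForm, hb, ← ratIncl_linFun]
  obtain ⟨_, Ψ, hΨ, rfl⟩ := a
  exact ratPoisson_sectionFun_base h hΨ _

end Dimension

variable [IsLieAbelian h]

theorem eval_homogEval (c : RatFun K h) (f : SymmetricAlgebra (RatFun K h) (imageAlg h)) :
    (homogEval h f).eval (algebraMap (RatFun K h) (RatFun K g) c) = evalRat h (rescale c f) := by
  have : (((aeval (algebraMap (RatFun K h) (RatFun K g) c)).restrictScalars (RatFun K h)).comp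
      (homogEval h)) = (evalRat h).comp (rescale c) := by
    refine SymmetricAlgebra.algHom_ext (LinearMap.ext fun a => ?_)
    change aeval _ (homogEval h (SymmetricAlgebra.ι _ _ a)) =
      evalRat h (rescale c (SymmetricAlgebra.ι _ _ a))
    rw [homogEval, SymmetricAlgebra.lift_ι_apply, homogLin_apply, rescale,
      SymmetricAlgebra.lift_ι_apply, LinearMap.smul_apply, map_smul, evalRat,
      SymmetricAlgebra.lift_ι_apply, Algebra.smul_def]
    rw [map_mul, aeval_C, aeval_X]
    exact mul_comm _ _
  have h2 := congrArg (fun G : SymmetricAlgebra (RatFun K h) (imageAlg h) →ₐ[RatFun K h]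
    RatFun K g => G f) this
  refine Eq.trans ?_ h2
  change _ = aeval _ _
  rw [coe_aeval_eq_eval]
  rfl

/-- With no linear functions from `h`, L_h lies in the span of algebraically independent linear
functions, without the constant 1. -/
theorem evalRat_injective_of_eq_bot [FiniteDimensional K g] (h0 : h = ⊥) :
    Function.Injective (evalRat h) := by
  obtain ⟨m, N, bh, b, hb⟩ := exists_adapted_basis h
  have hm : IsEmpty (Fin m) := by
    have : Subsingleton h := by rw [h0]; infer_instance
    by_contra hne
    rw [not_isEmpty_iff] at hne
    exact bh.ne_zero hne.some (Subsingleton.elim _ _)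
  refine lift_injective_of_algebraicIndependent (isTranscendenceBasis_complement hb).1 _
    (imageAlg h).subtype_injective fun a => ?_
  obtain ⟨_, Ψ, -, rfl⟩ := a
  refine sectionFun_mem_of_basis b (fun i => ?_) Ψ
  rcases i with i | j
  · exact hm.elim i
  · exact Submodule.subset_span ⟨j, rfl⟩

/-- Under the embedding into K(g*)[T] the minor becomes T^k times the determinant of the Poisson
brackets. -/
theorem bracketMinor_det_ne_zero [FiniteDimensional K g] {k : ℕ} {v w : Fin k → imageAlg h}
    (hvw : bracketMinor (K := RatFun K h) v w ≠ 0) :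
    (Matrix.of fun i j => ratPoisson (v i : RatFun K g) (w j : RatFun K g)).det ≠ 0 := by
  intro h0
  refine hvw (homogEval_injective h ?_)
  rw [map_zero, homogEval, lift_bracketMinor]
  have : (Matrix.of fun i j => homogLin h ⁅v i, w j⁆) =
      (X : (RatFun K g)[X]) • RingHom.mapMatrix (m := Fin k) (C : RatFun K g →+* (RatFun K g)[X])
        (Matrix.of fun i j => ratPoisson (v i : RatFun K g) (w j : RatFun K g)) := by
    ext1 i j
    simp only [Matrix.of_apply, homogLin_apply, Matrix.smul_apply, RingHom.mapMatrix_apply,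
      Matrix.map_apply, smul_eq_mul]
    rw [mul_comm]
    rfl
  rw [this, Matrix.det_smul, ← RingHom.map_det, h0, map_zero, mul_zero]
/-- The dimension count behind completeness; it compares the expected transcendence degrees. -/
theorem dim_add_index_le [FiniteDimensional K g] [CharZero K] {d : ℕ}
    (hd : d = 0 ∧ h = ⊥ ∨ d = 1 ∧ h ≠ ⊥) :
    finrank K g + index K g + 2 * d ≤
      2 * finrank K h + finrank (RatFun K h) (imageAlg h) +
        index (RatFun K h) (imageAlg h) := by
  obtain ⟨m, N, bh, b, hb⟩ := exists_adapted_basis h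
  obtain ⟨k, v, w, hk, hvw⟩ := exists_minor_ne_zero (finBasis (RatFun K h) (imageAlg h))
  have h1 := bracketMinor_det_ne_zero h hvw
  simp only [ratPoisson_eq_poissonForm b] at h1
  have h2 := minor_le_of_coisotropic (poissonForm_isRefl b) (idealSpan_isotropic hb) _ _
    (fun i => grad_mem_orthogonal hb _) (fun i => grad_mem_orthogonal hb _) h1
  rw [finrank_ker_poissonForm, finrank_fintype_fun_eq_card, ← finrank_eq_card_basis b] at h2
  have h3 := finrank_orthogonal_le hb
  have hm : finrank K h = m := by simpa using finrank_eq_card_basis bh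
  have hn : finrank K g = m + N := by simpa using finrank_eq_card_basis b
  have hx := isTranscendenceBasis_complement hb
  have hxr : ∀ j, linFun K g (b (Sum.inr j)) ∈ LinearMap.range (sectionFun h) := fun j =>
    ⟨1 ⊗ₜ b (Sum.inr j), by rw [sectionFun_tmul, map_one, one_mul]⟩
  rcases hd with ⟨rfl, -⟩ | ⟨rfl, h0⟩
  · have h4 := finrank_sections_add_card_le hx.1.linearIndependent hxr
    rw [Fintype.card_fin] at h4
    omega
  · have h5 : LinearIndependent (RatFun K h)
        (fun o : Option (Fin N) => o.elim 1 fun j => linFun K g (b (Sum.inr j))) := by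
      -- Independence of 1 and the `x_j` follows from that of T and the `x_j T`.
      refine LinearIndependent.of_comp
        ((Polynomial.monomial (R := RatFun K g) 1).restrictScalars (RatFun K h)) ?_
      rw [monomial_comp_elim]
      exact (algebraicIndependent_homogenized hx).linearIndependent
    have h6 := finrank_sections_add_card_le h5 (fun o => by
      rcases o with _ | j
      · obtain ⟨η, hη⟩ : ∃ η : h, η ≠ 0 := by
          by_contra! hall
          exact h0 (by
            rw [eq_bot_iff]
            intro x hx
            have := hall ⟨x, hx⟩
            simpa using congrArg Subtype.val this)
        have hne := linFun_ne_zero (K := K) hη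
        -- This rational map has f_Ψ = 1; the extra dimension is what pays for the loss under ε.
        refine ⟨(linFun K h η)⁻¹ ⊗ₜ (η : g), ?_⟩
        rw [sectionFun_tmul, ← ratIncl_linFun, ← map_mul, inv_mul_cancel₀ hne, map_one]
        rfl
      · exact hxr j)
    rw [Fintype.card_option, Fintype.card_fin] at h6
    omega

end Reduction

/-! ### Rescaling and the Poisson bracket -/

section Rescale

variable {K g : Type*} [Field K] [LieRing g] [LieAlgebra K g]

theorem rescale_ι (c : K) (x : g) :
    rescale c (SymmetricAlgebra.ι K g x) = c • SymmetricAlgebra.ι K g x := by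
  rw [rescale, SymmetricAlgebra.lift_ι_apply, LinearMap.smul_apply]

theorem poisson_ι_rescale (c : K) (x : g) (f : SymmetricAlgebra K g) :
    poisson (SymmetricAlgebra.ι K g x) (rescale c f) =
      rescale c (poisson (SymmetricAlgebra.ι K g x) f) := by
  simp only [poisson]
  induction f using SymmetricAlgebra.induction with
  | algebraMap r => simp
  | ι y =>
    have h1 := poisson_ι (K := K) x y
    simp only [poisson] at h1
    rw [rescale_ι, Derivation.map_smul, h1, rescale_ι]
  | mul a b ha hb =>
    simp only [map_mul, Derivation.leibniz, smul_eq_mul, map_add, ha, hb]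
  | add a b ha hb => simp only [map_add, ha, hb]

/-- The bracket lowers the degree by one, hence the extra factor `c`. -/
theorem poisson_rescale (c : K) (f₁ f₂ : SymmetricAlgebra K g) :
    poisson (rescale c f₁) (rescale c f₂) = c • rescale c (poisson f₁ f₂) := by
  simp only [poisson]
  induction f₂ using SymmetricAlgebra.induction with
  | algebraMap r => simp
  | ι y =>
    have h1 := poisson_skew (rescale c f₁) (SymmetricAlgebra.ι K g y)
    have h2 := poisson_skew f₁ (SymmetricAlgebra.ι K g y)
    rw [poisson_ι_rescale] at h1
    simp only [poisson] at h1 h2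
    rw [rescale_ι, Derivation.map_smul, h1, h2, map_neg]
  | mul a b ha hb =>
    simp only [map_mul, Derivation.leibniz, smul_eq_mul, map_add, ha, hb, smul_add,
      mul_smul_comm]
  | add a b ha hb => simp only [map_add, ha, hb, smul_add]

theorem IsCommutative.map_rescale {A : Subalgebra K (SymmetricAlgebra K g)}
    (hA : IsCommutative A) (c : K) : IsCommutative (A.map (rescale c)) := by
  rintro _ ⟨f₁, h₁, rfl⟩ _ ⟨f₂, h₂, rfl⟩
  have := poisson_rescale c f₁ f₂
  rw [hA f₁ h₁ f₂ h₂, map_zero, smul_zero] at this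
  exact this

theorem rescale_injective {c : K} (hc : c ≠ 0) :
    Function.Injective (rescale c : SymmetricAlgebra K g →ₐ[K] SymmetricAlgebra K g) := by
  have : (rescale c⁻¹).comp (rescale c) = AlgHom.id K (SymmetricAlgebra K g) := by
    refine SymmetricAlgebra.algHom_ext (LinearMap.ext fun x => ?_)
    change rescale c⁻¹ (rescale c (SymmetricAlgebra.ι K g x)) = SymmetricAlgebra.ι K g x
    rw [rescale_ι, map_smul, rescale_ι, smul_smul, mul_inv_cancel₀ hc, one_smul]
  exact Function.LeftInverse.injective (g := rescale c⁻¹)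
    fun f => congrArg (fun G : SymmetricAlgebra K g →ₐ[K] SymmetricAlgebra K g => G f) this

theorem rescale_of_mem_pow (c : K) (n : ℕ) {f : SymmetricAlgebra K g}
    (hf : f ∈ (LinearMap.range (SymmetricAlgebra.ι K g)) ^ n) : rescale c f = c ^ n • f := by
  induction hf using Submodule.pow_induction_on_left' with
  | algebraMap r => simp
  | add x y i hx hy ihx ihy => rw [map_add, ihx, ihy, smul_add]
  | mem_mul m hm i x hx ih =>
    obtain ⟨y, rfl⟩ := hm
    rw [map_mul, rescale_ι, ih, smul_mul_smul_comm, pow_succ']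

/-- Rescaling multiplies the component of degree n by c^n; this preserves `A`, and the same for
`c⁻¹` gives surjectivity onto `A`. -/
theorem IsHomogeneous.map_rescale {A : Subalgebra K (SymmetricAlgebra K g)}
    (hA : IsHomogeneous A) {c : K} (hc : c ≠ 0) : A.map (rescale c) = A := by
  have key : ∀ c : K, ∀ f ∈ A, rescale c f ∈ A := fun c f hf => by
    have hle : (⨆ n : ℕ, A.toSubmodule ⊓ (LinearMap.range (SymmetricAlgebra.ι K g)) ^ n) ≤
        A.toSubmodule.comap (rescale c).toLinearMap := by
      refine iSup_le fun n x hx => ?_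
      change rescale c x ∈ A
      rw [rescale_of_mem_pow c n hx.2]
      exact A.smul_mem hx.1 _
    exact hle (hA f hf)
  refine le_antisymm ?_ fun f hf => ?_
  · rintro _ ⟨f, hf, rfl⟩
    exact key c f hf
  · have hid : (rescale c).comp (rescale c⁻¹) = AlgHom.id K (SymmetricAlgebra K g) := by
      refine SymmetricAlgebra.algHom_ext (LinearMap.ext fun x => ?_)
      change rescale c (rescale c⁻¹ (SymmetricAlgebra.ι K g x)) = SymmetricAlgebra.ι K g x
      rw [rescale_ι, map_smul, rescale_ι, smul_smul, inv_mul_cancel₀ hc, one_smul]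
    exact ⟨rescale c⁻¹ f, key _ f hf,
      congrArg (fun G : SymmetricAlgebra K g →ₐ[K] SymmetricAlgebra K g => G f) hid⟩

end Rescale

/-! ### Clearing denominators and completeness of the polynomial part -/

section PolynomialPart

open Module

variable {K g : Type*} [Field K] [LieRing g] [LieAlgebra K g] (h : LieIdeal K g)

theorem algebraMap_symIncl (q : SymmetricAlgebra K h) :
    algebraMap (SymmetricAlgebra K g) (RatFun K g) (symIncl h q) =
      algebraMap (RatFun K h) (RatFun K g) (algebraMap _ (RatFun K h) q) :=
  (IsFractionRing.lift_algebraMap (K := RatFun K h) (symIncl_rat_injective h) q).symm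

/-- `f` is a polynomial divided by a polynomial on `h*`. -/
def HasBaseDenominator (f : RatFun K g) : Prop :=
  ∃ (q : SymmetricAlgebra K h) (p : SymmetricAlgebra K g), q ≠ 0 ∧
    algebraMap _ (RatFun K g) p = algebraMap _ (RatFun K g) (symIncl h q) * f

variable {h}

theorem HasBaseDenominator.add {f₁ f₂ : RatFun K g} (h₁ : HasBaseDenominator h f₁)
    (h₂ : HasBaseDenominator h f₂) : HasBaseDenominator h (f₁ + f₂) := by
  obtain ⟨q₁, p₁, hq₁, e₁⟩ := h₁
  obtain ⟨q₂, p₂, hq₂, e₂⟩ := h₂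
  refine ⟨q₁ * q₂, symIncl h q₂ * p₁ + symIncl h q₁ * p₂, mul_ne_zero hq₁ hq₂, ?_⟩
  simp only [map_add, map_mul, e₁, e₂]
  ring

theorem HasBaseDenominator.mul {f₁ f₂ : RatFun K g} (h₁ : HasBaseDenominator h f₁)
    (h₂ : HasBaseDenominator h f₂) : HasBaseDenominator h (f₁ * f₂) := by
  obtain ⟨q₁, p₁, hq₁, e₁⟩ := h₁
  obtain ⟨q₂, p₂, hq₂, e₂⟩ := h₂
  refine ⟨q₁ * q₂, p₁ * p₂, mul_ne_zero hq₁ hq₂, ?_⟩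
  simp only [map_mul, e₁, e₂]
  ring

theorem hasBaseDenominator_algebraMap (f : SymmetricAlgebra K g) :
    HasBaseDenominator h (algebraMap _ (RatFun K g) f) :=
  ⟨1, f, one_ne_zero, by rw [map_one, map_one, one_mul]⟩

theorem hasBaseDenominator_base (a : RatFun K h) :
    HasBaseDenominator h (algebraMap (RatFun K h) (RatFun K g) a) := by
  obtain ⟨p, q, hq, rfl⟩ := IsFractionRing.div_surjective (A := SymmetricAlgebra K h) a
  have hq' : algebraMap _ (RatFun K h) q ≠ 0 :=
    IsFractionRing.to_map_ne_zero_of_mem_nonZeroDivisors hq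
  refine ⟨q, symIncl h p, nonZeroDivisors.ne_zero hq, ?_⟩
  rw [algebraMap_symIncl, algebraMap_symIncl, ← map_mul, mul_div_cancel₀ _ hq']

theorem hasBaseDenominator_sectionFun (Ψ : RatFun K h ⊗[K] g) :
    HasBaseDenominator h (sectionFun h Ψ) := by
  induction Ψ using TensorProduct.induction_on with
  | zero => rw [map_zero, ← map_zero (algebraMap (SymmetricAlgebra K g) (RatFun K g))]
            exact hasBaseDenominator_algebraMap 0
  | tmul a ξ =>
    rw [sectionFun_tmul]
    exact (hasBaseDenominator_base a).mul (hasBaseDenominator_algebraMap (SymmetricAlgebra.ι K g ξ))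
  | add x y hx hy => rw [map_add]; exact hx.add hy

theorem symIncl_mem_polyPart (B : Subalgebra (RatFun K h) (RatFun K g))
    (q : SymmetricAlgebra K h) : symIncl h q ∈ polyPart h B := by
  change algebraMap _ _ _ ∈ B
  rw [algebraMap_symIncl]
  exact B.algebraMap_mem _

theorem isCommutative_polyPart {B : Subalgebra (RatFun K h) (RatFun K g)}
    (hB : IsRatCommutative h B) : IsCommutative (polyPart h B) := fun f₁ h₁ f₂ h₂ =>
  IsFractionRing.injective (SymmetricAlgebra K g) (RatFun K g) (by
    rw [algebraMap_poisson, map_zero]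
    exact hB _ h₁ _ h₂)

/-- `B` contains K(h*), so the elements of `h` themselves belong to its commutative polynomial part.
-/
theorem polyPart_le_ann {B : Subalgebra (RatFun K h) (RatFun K g)}
    (hB : IsRatCommutative h B) : polyPart h B ≤ ann h := fun f hf η => by
  refine isCommutative_polyPart hB _ ?_ _ hf
  have := symIncl_mem_polyPart B (SymmetricAlgebra.ι K h η)
  rwa [symIncl, SymmetricAlgebra.lift_ι_apply] at this

theorem trdeg_ratFun_lt_aleph0 [FiniteDimensional K g] :
    Algebra.trdeg (RatFun K h) (RatFun K g) < Cardinal.aleph0 := by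
  obtain ⟨m, N, bh, b, hb⟩ := exists_adapted_basis h
  have := (isTranscendenceBasis_complement hb).lift_cardinalMk_eq_trdeg
  rw [Cardinal.mk_fin, Cardinal.lift_natCast] at this
  rw [Cardinal.lift_eq_nat_iff.mp this.symm]
  exact Cardinal.natCast_lt_aleph0

variable [IsLieAbelian h]

theorem evalRat_ι (a : imageAlg h) :
    evalRat h (SymmetricAlgebra.ι (RatFun K h) (imageAlg h) a) = a := by
  rw [evalRat, SymmetricAlgebra.lift_ι_apply]
  rfl

theorem hasBaseDenominator_evalRat (f : SymmetricAlgebra (RatFun K h) (imageAlg h)) :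
    HasBaseDenominator h (evalRat h f) := by
  induction f using SymmetricAlgebra.induction with
  | algebraMap r => rw [AlgHom.commutes]; exact hasBaseDenominator_base r
  | ι a =>
    obtain ⟨_, Ψ, hΨ, rfl⟩ := a
    rw [evalRat_ι]
    exact hasBaseDenominator_sectionFun Ψ
  | mul a b ha hb => rw [map_mul]; exact ha.mul hb
  | add a b ha hb => rw [map_add]; exact ha.add hb

/-- The polynomial part has the full transcendence degree, because denominators of elements of the
image of `S(L_h)` can be chosen on `h*`. -/
theorem le_trdeg_polyPart [FiniteDimensional K g] {B : Subalgebra (RatFun K h) (RatFun K g)}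
    (hB : B ≤ (evalRat h).range) {k : ℕ} (hk : (k : Cardinal) ≤ Algebra.trdeg (RatFun K h) B) :
    ((finrank K h + k : ℕ) : Cardinal) ≤ Algebra.trdeg K (polyPart h B) := by
  have hF : Algebra.trdeg K (RatFun K h) = (finrank K h : Cardinal) := by
    have := (isTranscendenceBasis_linFun (finBasis K h)).lift_cardinalMk_eq_trdeg
    rw [Cardinal.mk_fin, Cardinal.lift_natCast] at this
    exact Cardinal.lift_eq_nat_iff.mp this.symm
  let φ : polyPart h B →+* B :=
    { toFun := fun f => ⟨algebraMap _ (RatFun K g) (f : SymmetricAlgebra K g), f.2⟩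
      map_one' := Subtype.ext (map_one _)
      map_mul' := fun _ _ => Subtype.ext (map_mul _ _ _)
      map_zero' := Subtype.ext (map_zero _)
      map_add' := fun _ _ => Subtype.ext (map_add _ _ _) }
  have hφ : Function.Injective φ := fun a b hab => by
    have := congrArg Subtype.val hab
    exact Subtype.ext (IsFractionRing.injective (SymmetricAlgebra K g) (RatFun K g) this)
  let : Algebra (polyPart h B) B := φ.toAlgebra
  have : IsScalarTower K (polyPart h B) B := .of_algebraMap_eq fun r => Subtype.ext (by
    change algebraMap K (RatFun K g) r = algebraMap _ (RatFun K g) (algebraMap K _ r)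
    rw [← IsScalarTower.algebraMap_apply])
  -- A denominator `q` from S(h) lies in the polynomial part, and so does `q * f`; hence `f` is a
  -- quotient of elements of that part.
  have halg : Algebra.IsAlgebraic (polyPart h B) B := ⟨fun f => by
    obtain ⟨s, hs⟩ := hB f.2
    obtain ⟨q, p, hq, hp⟩ := hasBaseDenominator_evalRat s
    have hs' : evalRat h s = f := hs
    rw [hs'] at hp
    have hpB : p ∈ polyPart h B := by
      change algebraMap _ _ _ ∈ B
      rw [hp]
      exact B.mul_mem (symIncl_mem_polyPart B q) f.2
    refine isAlgebraic_of_mul_eq (r := ⟨symIncl h q, symIncl_mem_polyPart B q⟩) (s := ⟨p, hpB⟩)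
      (fun h0 => hq ?_) (Subtype.ext hp.symm)
    have := congrArg Subtype.val h0
    exact symIncl_injective h (this.trans (map_zero _).symm)⟩
  have hf1 : FaithfulSMul (polyPart h B) B := (faithfulSMul_iff_algebraMap_injective _ _).mpr hφ
  have hf2 : FaithfulSMul K (polyPart h B) :=
    (faithfulSMul_iff_algebraMap_injective _ _).mpr (algebraMap K (polyPart h B)).injective
  have hf3 : FaithfulSMul (RatFun K h) B :=
    (faithfulSMul_iff_algebraMap_injective _ _).mpr (algebraMap (RatFun K h) B).injective
  -- The degree of `B` over `K` is computed through the polynomial part, which contributes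
  -- everything, and through K(h*), which contributes dim h.
  have h1 := trdeg_add_eq K (polyPart h B) (A := B)
  have h2 := trdeg_add_eq K (RatFun K h) (A := B)
  rw [trdeg_eq_zero (R := polyPart h B), add_zero] at h1
  rw [h1, ← h2, hF, Nat.cast_add]
  gcongr

theorem ratPoisson_evalRat_base (f : SymmetricAlgebra (RatFun K h) (imageAlg h)) (r : RatFun K h) :
    ratPoisson (evalRat h f) (algebraMap (RatFun K h) (RatFun K g) r) = 0 := by
  induction f using SymmetricAlgebra.induction with
  | algebraMap s => rw [AlgHom.commutes]; exact ratPoisson_base_base h s r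
  | ι a =>
    obtain ⟨_, Ψ, hΨ, rfl⟩ := a
    rw [evalRat_ι]
    exact ratPoisson_sectionFun_base h hΨ r
  | mul a b ha hb => rw [map_mul, ratPoisson_mul_left, ha, hb, mul_zero, mul_zero, add_zero]
  | add a b ha hb => rw [map_add, ratPoisson_add_left, ha, hb, add_zero]

/-- By the Leibniz rule it suffices to compare generators: on L_h the brackets agree by definition,
and scalars from K(h*) commute with the whole image. -/
theorem ratPoisson_evalRat (f₁ f₂ : SymmetricAlgebra (RatFun K h) (imageAlg h)) :
    ratPoisson (evalRat h f₁) (evalRat h f₂) = evalRat h (poisson f₁ f₂) := by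
  have key : ∀ (a : imageAlg h) (f : SymmetricAlgebra (RatFun K h) (imageAlg h)),
      ratPoisson (a : RatFun K g) (evalRat h f) =
        evalRat h (poisson (SymmetricAlgebra.ι (RatFun K h) (imageAlg h) a) f) := by
    intro a f
    induction f using SymmetricAlgebra.induction with
    | algebraMap r =>
      rw [AlgHom.commutes, ← evalRat_ι a, ratPoisson_evalRat_base]
      simp [poisson]
    | ι b => rw [poisson_ι, evalRat_ι, evalRat_ι]; rfl
    | mul x y hx hy =>
      rw [map_mul, ratPoisson_mul_right, hx, hy]
      simp [poisson]
    | add x y hx hy =>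
      rw [map_add, ratPoisson_add_right, hx, hy]
      simp [poisson]
  induction f₂ using SymmetricAlgebra.induction with
  | algebraMap r =>
    rw [AlgHom.commutes, ratPoisson_evalRat_base]
    simp [poisson]
  | ι b => rw [evalRat_ι, ratPoisson_skew, key, poisson_skew f₁, map_neg]
  | mul x y hx hy =>
    rw [map_mul, ratPoisson_mul_right, hx, hy]
    simp [poisson]
  | add x y hx hy =>
    rw [map_add, ratPoisson_add_right, hx, hy]
    simp [poisson]

theorem IsCommutative.map_evalRat
    {A : Subalgebra (RatFun K h) (SymmetricAlgebra (RatFun K h) (imageAlg h))}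
    (hA : IsCommutative A) : IsRatCommutative h (A.map (evalRat h)) := by
  rintro _ ⟨f₁, h₁, rfl⟩ _ ⟨f₂, h₂, rfl⟩
  have := ratPoisson_evalRat f₁ f₂
  rw [hA f₁ h₁ f₂ h₂, map_zero] at this
  exact this

theorem map_evalRat_le_range
    (A : Subalgebra (RatFun K h) (SymmetricAlgebra (RatFun K h) (imageAlg h))) :
    A.map (evalRat h) ≤ (evalRat h).range := by
  rintro _ ⟨f, -, rfl⟩
  exact ⟨f, rfl⟩

theorem isCompleteCommutative_polyPart [FiniteDimensional K g] [CharZero K]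
    {B : Subalgebra (RatFun K h) (RatFun K g)} (hB : B ≤ (evalRat h).range)
    (hc : IsRatCommutative h B) {k : ℕ} (hk : (k : Cardinal) ≤ Algebra.trdeg (RatFun K h) B)
    (hle : finrank K g + index K g ≤ 2 * (finrank K h + k)) :
    IsCompleteCommutative (polyPart h B) :=
  isCompleteCommutative_of_le (isCommutative_polyPart hc) (le_trdeg_polyPart hB hk) hle

/-- For almost all `c`, the image of `θ_c A` has the transcendence degree required for
completeness. -/
theorem exists_finite_large_trdeg [FiniteDimensional K g] [CharZero K]
    {A : Subalgebra (RatFun K h) (SymmetricAlgebra (RatFun K h) (imageAlg h))}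
    (hA : IsCompleteCommutative A) :
    ∃ (k : ℕ) (Z : Set (RatFun K h)), Z.Finite ∧
      finrank K g + index K g ≤ 2 * (finrank K h + k) ∧ ∀ c ∉ Z, c ≠ 0 →
        (k : Cardinal) ≤ Algebra.trdeg (RatFun K h) ((A.map (rescale c)).map (evalRat h)) := by
  -- Twice the transcendence degree is a natural number, so the degree itself is finite.
  obtain ⟨t, ht⟩ : ∃ t : ℕ, Algebra.trdeg (RatFun K h) A = t := by
    refine Cardinal.lt_aleph0.mp ?_
    by_contra! hinf
    have h1 := hA.2
    have h3 : Algebra.trdeg (RatFun K h) A ≤ 2 * Algebra.trdeg (RatFun K h) A :=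
      Cardinal.le_mul_left two_ne_zero
    rw [h1] at h3
    exact absurd (hinf.trans h3) (not_le.mpr Cardinal.natCast_lt_aleph0)
  have h2 : 2 * t = finrank (RatFun K h) (imageAlg h) + index (RatFun K h) (imageAlg h) := by
    have := hA.2
    rw [ht] at this
    exact_mod_cast this
  obtain ⟨f, hf⟩ := natCast_le_trdeg_iff.mp ht.ge
  have hf' : AlgebraicIndependent (RatFun K h)
      fun i => (f i : SymmetricAlgebra (RatFun K h) (imageAlg h)) :=
    hf.map' (f := A.val) Subtype.val_injective
  have hlift : ∀ {k : ℕ} (c : RatFun K h) (e : Fin k → Fin t),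
      AlgebraicIndependent (RatFun K h) (fun i => evalRat h (rescale c (f (e i)))) →
      (k : Cardinal) ≤ Algebra.trdeg (RatFun K h) ((A.map (rescale c)).map (evalRat h)) :=
    fun c e he => natCast_le_trdeg_iff.mpr
      ⟨fun i => ⟨_, _, ⟨_, (f (e i)).2, rfl⟩, rfl⟩, AlgebraicIndependent.of_comp
        ((A.map (rescale c)).map (evalRat h)).val he⟩
  by_cases h0 : h = ⊥
  · have h3 := dim_add_index_le h (d := 0) (Or.inl ⟨rfl, h0⟩)
    refine ⟨t, ∅, Set.finite_empty, by omega, fun c _ hc => hlift c id ?_⟩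
    exact hf'.map' (f := (evalRat h).comp (rescale c))
      ((evalRat_injective_of_eq_bot h h0).comp (rescale_injective hc))
  · have h3 := dim_add_index_le h (d := 1) (Or.inr ⟨rfl, h0⟩)
    obtain ⟨Z, hZ, hsp⟩ := exists_finite_specialization trdeg_ratFun_lt_aleph0
      (hf'.map' (homogEval_injective h))
    -- One degree is lost in the specialization T = c; the term `2 * d` with d = 1 in the dimension
    -- count compensates for it.
    refine ⟨t - 1, Z, hZ, by omega, fun c hcZ _ => ?_⟩
    obtain ⟨e, he⟩ := hsp c hcZ
    refine hlift c e ?_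
    convert he using 1
    funext i
    exact (eval_homogEval h c _).symm

end PolynomialPart

end LiePoisson

end

/-! ### Assembly of the statement -/

theorem proposition4 {K g : Type*} [Field K] [CharZero K] [LieRing g] [LieAlgebra K g]
    [FiniteDimensional K g] (h : LieIdeal K g) [IsLieAbelian h] :
    -- the Mishchenko-Fomenko property passes from `L_h` over `K(h*)` to `g` over `K`
    (LiePoisson.HasCompleteCommutative (LiePoisson.RatFun K h) (LiePoisson.imageAlg h) →
      LiePoisson.HasCompleteCommutative K g) ∧
    -- polynomial parts of commutative subalgebras of the image of `S(L_h)` in `K(g*)`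
    (∀ B : Subalgebra (LiePoisson.RatFun K h) (LiePoisson.RatFun K g),
      B ≤ (LiePoisson.evalRat h).range → LiePoisson.IsRatCommutative h B →
        LiePoisson.IsCommutative (LiePoisson.polyPart h B) ∧
        LiePoisson.polyPart h B ≤ LiePoisson.ann h) ∧
    ∀ A : Subalgebra (LiePoisson.RatFun K h)
        (SymmetricAlgebra (LiePoisson.RatFun K h) (LiePoisson.imageAlg h)),
      LiePoisson.IsCompleteCommutative A →
        -- the polynomialization of `A`
        (LiePoisson.IsCommutative (LiePoisson.polynomialization h A) ∧
          LiePoisson.polynomialization h A ≤ LiePoisson.ann h) ∧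
        (LiePoisson.IsHomogeneous A →
          LiePoisson.IsCompleteCommutative (LiePoisson.polynomialization h A)) ∧
        {c : LiePoisson.RatFun K h | c ≠ 0 ∧ ¬ LiePoisson.IsCompleteCommutative
          (LiePoisson.polynomialization h (A.map (LiePoisson.rescale c)))}.Finite ∧
        -- complete commutative subalgebras of the image of `S(L_h)` in `K(g*)`
        ∀ B : Subalgebra (LiePoisson.RatFun K h) (LiePoisson.RatFun K g),
          B ≤ (LiePoisson.evalRat h).range → LiePoisson.IsRatCommutative h B →
          (∀ B' : Subalgebra (LiePoisson.RatFun K h) (LiePoisson.RatFun K g),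
            B' ≤ (LiePoisson.evalRat h).range → LiePoisson.IsRatCommutative h B' →
            Algebra.trdeg (LiePoisson.RatFun K h) B' ≤ Algebra.trdeg (LiePoisson.RatFun K h) B) →
          LiePoisson.IsCompleteCommutative (LiePoisson.polyPart h B) := by
  have hinf : Infinite (LiePoisson.RatFun K h) :=
    Infinite.of_injective _ (algebraMap K (LiePoisson.RatFun K h)).injective
  have hgood : ∀ A : Subalgebra (LiePoisson.RatFun K h)
      (SymmetricAlgebra (LiePoisson.RatFun K h) (LiePoisson.imageAlg h)),
      LiePoisson.IsCompleteCommutative A →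
      {c : LiePoisson.RatFun K h | c ≠ 0 ∧ ¬ LiePoisson.IsCompleteCommutative
        (LiePoisson.polynomialization h (A.map (LiePoisson.rescale c)))}.Finite := by
    intro A hA
    obtain ⟨k, Z, hZ, hk, hlarge⟩ := LiePoisson.exists_finite_large_trdeg hA
    refine hZ.subset fun c hc => ?_
    by_contra hcZ
    exact hc.2 (LiePoisson.isCompleteCommutative_polyPart (LiePoisson.map_evalRat_le_range _)
      (hA.1.map_rescale c).map_evalRat (hlarge c hcZ hc.1) hk)
  have hex : ∀ Z : Set (LiePoisson.RatFun K h), Z.Finite → ∃ c, c ∉ Z ∧ c ≠ 0 := by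
    intro Z hZ
    obtain ⟨c, hc⟩ := (hZ.insert 0).exists_notMem
    exact ⟨c, fun h1 => hc (Or.inr h1), fun h1 => hc (Or.inl h1)⟩
  refine ⟨?_, fun B _ hB => ⟨LiePoisson.isCommutative_polyPart hB, LiePoisson.polyPart_le_ann hB⟩,
    fun A hA => ⟨⟨LiePoisson.isCommutative_polyPart hA.1.map_evalRat,
      LiePoisson.polyPart_le_ann hA.1.map_evalRat⟩, ?_, hgood A hA, ?_⟩⟩
  · rintro ⟨A, hA⟩
    obtain ⟨c, hc, hc0⟩ := hex _ (hgood A hA)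
    exact ⟨_, not_not.mp fun hn => hc ⟨hc0, hn⟩⟩
  · intro hhom
    obtain ⟨c, hc, hc0⟩ := hex _ (hgood A hA)
    have h1 : LiePoisson.IsCompleteCommutative
        (LiePoisson.polynomialization h (A.map (LiePoisson.rescale c))) :=
      not_not.mp fun hn => hc ⟨hc0, hn⟩
    -- A homogeneous `A` is its own rescaling, so the good parameter `c` says something about `A`
    -- itself.
    rwa [hhom.map_rescale hc0] at h1
  · intro B hB hcomm hmax
    obtain ⟨k, Z, hZ, hk, hlarge⟩ := LiePoisson.exists_finite_large_trdeg hA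
    obtain ⟨c, hc, hc0⟩ := hex Z hZ
    -- The image of a generic rescaling of `A` competes with `B`, so maximality transfers its lower
    -- bound to `B`.
    exact LiePoisson.isCompleteCommutative_polyPart hB hcomm
      ((hlarge c hc hc0).trans (hmax _ (LiePoisson.map_evalRat_le_range _)
        (hA.1.map_rescale c).map_evalRat)) hk
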